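/- Let $n,m\ge 1$ be integers and let $M_{n,m}(\mathbb{R})$ be the space of real $n\times m$ matrices with inner product $x\cdot y=\mathrm{tr}(x^{T}y)$ and unit sphere $S^{nm-1}$; identify $M_{n,1}(\mathbb{R})$ with $\mathbb{R}^n$ and $M_{1,m}(\mathbb{R})$ with $\mathbb{R}^m$. A convex body is a compact convex set with nonempty interior. The support function of a convex body $L$ is $h_L(x)=\max_{y\in L}x\cdot y$. Let $K\subset\mathbb{R}^n$ be a Lipschitz star body about the origin $o$: $K$ is star-shaped about $o$, and its radial function $\rho_K(x)=\sup\{\lambda\ge 0:\lambda x\in K\}$ ($x\neq o$) is finite, strictly positive and Lipschitz on the unit sphere $S^{n-1}$. Let $\partial^*K$ be the set of $z\in\partial K$ at which $\nabla\rho_K(z)$ exists, let $\nu_K(z)$ be the outer unit normal of $K$ at $z\in\partial^*K$, and let $\mathcal{H}^{n-1}$ be the $(n-1)$-dimensional Hausdorff measure. Let $p\ge 1$ be real and let $Q\subset\mathbb{R}^m$ be a convex body with $o\in Q$. Put, for $x\in M_{n,m}(\mathbb{R})$, $$h_{\Pi_{p,Q}K}(x)=\Big(\int_{\partial^*K}h_Q\big(\nu_K(z)^{T}x\big)^p\,\big(z\cdot\nu_K(z)\big)^{1-p}\,d\mathcal{H}^{n-1}(z)\Big)^{1/p}\in[0,\infty],$$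 and let $\Pi_{p,Q}K=\{y\in M_{n,m}(\mathbb{R}): x\cdot y\le h_{\Pi_{p,Q}K}(x)\text{ for all }x\in M_{n,m}(\mathbb{R})\}$. Then the following hold. (i) For every $u\in S^{nm-1}$, $0<h_{\Pi_{p,Q}K}(u)<\infty$. (ii) $h_{\Pi_{p,Q}K}$ is sublinear, that is, $h_{\Pi_{p,Q}K}(x+y)\le h_{\Pi_{p,Q}K}(x)+h_{\Pi_{p,Q}K}(y)$ and $h_{\Pi_{p,Q}K}(cx)=c\,h_{\Pi_{p,Q}K}(x)$ for all $x,y\in M_{n,m}(\mathbb{R})$ and $c\ge 0$; and $\Pi_{p,Q}K$ is a convex body that contains $o$ in its interior and whose support function is $h_{\Pi_{p,Q}K}$. (iii) For all $a,b>0$, $\Pi_{p,bQ}(aK)=b\,a^{\frac{n-p}{p}}\,\Pi_{p,Q}K$. (iv) For every $\phi\in GL(n)$, $\Pi_{p,Q}(\phi K)=|\det\phi|^{1/p}\,\phi^{-T}\,\Pi_{p,Q}K$, where $\phi^{-T}=(\phi^{-1})^{T}$. -/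

import Mathlib

open MeasureTheory Filter Topology
open scoped ENNReal Pointwise

noncomputable section

namespace StarProj

/-- The space `M_{n,m}(ℝ)` of real `n × m` matrices. -/
abbrev Mat (n m : ℕ) : Type := Matrix (Fin n) (Fin m) ℝ

/-- The Euclidean space `ℝⁿ`, identified with `M_{n,1}(ℝ)` and also with `M_{1,n}(ℝ)`. -/
abbrev Vec (n : ℕ) : Type := EuclideanSpace ℝ (Fin n)

/-- The standard inner product `tr (xᵀ y)` on `M_{n,m}(ℝ)`. -/
def matInner {n m : ℕ} (x y : Mat n m) : ℝ := (x.transpose * y).trace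

/-- The norm `√(x · x)` on `M_{n,m}(ℝ)`. -/
def matNorm {n m : ℕ} (x : Mat n m) : ℝ := Real.sqrt (matInner x x)

/-- A convex body: a compact convex set with nonempty interior. -/
def IsConvexBody {E : Type*} [TopologicalSpace E] [AddCommGroup E] [Module ℝ E]
    (K : Set E) : Prop :=
  Convex ℝ K ∧ IsCompact K ∧ (interior K).Nonempty

/-- The support function of a subset of `ℝᵐ`. -/
def supportFn {m : ℕ} (Q : Set (Vec m)) (w : Vec m) : ℝ :=
  sSup ((fun q => inner ℝ w q) '' Q)

/-- The support function of a subset of `M_{n,m}(ℝ)`. -/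
def matSupportFn {n m : ℕ} (L : Set (Mat n m)) (x : Mat n m) : ℝ :=
  sSup ((fun y => matInner x y) '' L)

/-- The radial function `ρ_K(x) = sup {l ≥ 0 : l x ∈ K}`; only its values at `x ≠ 0` matter.
(If the supremum is infinite, the value is `0`.) -/
def radialFn {n : ℕ} (K : Set (Vec n)) (x : Vec n) : ℝ :=
  sSup {l : ℝ | 0 ≤ l ∧ l • x ∈ K}

/-- A star body about the origin: a set which is star-shaped about `o` and whose radial function is
(finite,) strictly positive and continuous on the unit sphere. -/
def IsStarBody {n : ℕ} (K : Set (Vec n)) : Prop :=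
  StarConvex ℝ 0 K ∧
  (∀ u ∈ Metric.sphere (0 : Vec n) 1, 0 < radialFn K u) ∧
  ContinuousOn (radialFn K) (Metric.sphere (0 : Vec n) 1)

/-- A Lipschitz star body about the origin: a star body whose boundary
`{ρ_K(u) u : u ∈ S^{n-1}}` is Lipschitz as a radial graph over the sphere, that is, whose radial
function is Lipschitz on the unit sphere. -/
def IsLipschitzStarBody {n : ℕ} (K : Set (Vec n)) : Prop :=
  IsStarBody K ∧ ∃ C : NNReal, LipschitzOnWith C (radialFn K) (Metric.sphere (0 : Vec n) 1)

/-- The regular part of the boundary: the boundary points at which `∇ρ_K` exists. -/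
def regBoundary {n : ℕ} (K : Set (Vec n)) : Set (Vec n) :=
  {z | z ∈ frontier K ∧ DifferentiableAt ℝ (radialFn K) z}

/-- `v` is the outer unit normal of `K` at `z`: near `z`, to first order, `K` is the half-space
`{y : v · (y - z) ≤ 0}`. -/
def IsOuterUnitNormal {n : ℕ} (K : Set (Vec n)) (z v : Vec n) : Prop :=
  ‖v‖ = 1 ∧ ∀ ε : ℝ, 0 < ε → ∀ᶠ y in 𝓝 z,
    (y ∈ K → inner ℝ v (y - z) ≤ ε * ‖y - z‖) ∧
    (y ∉ K → -(ε * ‖y - z‖) ≤ inner ℝ v (y - z))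

/-- There is at most one outer unit normal at a given point. -/
theorem IsOuterUnitNormal.unique {n : ℕ} {K : Set (Vec n)} {z v v' : Vec n}
    (h : IsOuterUnitNormal K z v) (h' : IsOuterUnitNormal K z v') : v = v' := by
  by_contra hne
  set w : Vec n := v' - v with hw
  have hw0 : 0 < ‖w‖ := norm_pos_iff.2 (sub_ne_zero.2 (Ne.symm hne))
  have e1 : ‖w‖ ^ 2 = 2 - 2 * inner ℝ v v' := by
    rw [hw, norm_sub_sq_real, h.1, h'.1, real_inner_comm]; ring
  have a1 : inner ℝ v w = -(‖w‖ ^ 2 / 2) := by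
    rw [e1, hw, inner_sub_right, real_inner_self_eq_norm_sq, h.1]; ring
  have a2 : inner ℝ v' w = ‖w‖ ^ 2 / 2 := by
    rw [e1, hw, inner_sub_right, real_inner_self_eq_norm_sq, h'.1, real_inner_comm]; ring
  have hε : 0 < ‖w‖ / 4 := by positivity
  have ht : Tendsto (fun t : ℝ => z + t • w) (𝓝[>] 0) (𝓝 z) := by
    have : Continuous (fun t : ℝ => z + t • w) := by fun_prop
    have h0 := this.tendsto 0
    simp only [zero_smul, add_zero] at h0
    exact h0.mono_left nhdsWithin_le_nhds
  have hev := (ht.eventually ((h.2 _ hε).and (h'.2 _ hε))).and self_mem_nhdsWithin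
  obtain ⟨t, ⟨hA, hB⟩, ht0⟩ := hev.exists
  have ht0 : 0 < t := ht0
  simp only [add_sub_cancel_left, inner_smul_right, norm_smul, Real.norm_eq_abs,
    abs_of_pos ht0, a1, a2] at hA hB
  have hpos : 0 < t * ‖w‖ ^ 2 := by positivity
  by_cases hy : z + t • w ∈ K
  · have := hB.1 hy
    nlinarith
  · have := hA.2 hy
    nlinarith

open Classical in
/-- The Gauss map `ν_K`: the outer unit normal of `K` at `z` where it exists, and `0` elsewhere. -/
def gaussMap {n : ℕ} (K : Set (Vec n)) (z : Vec n) : Vec n :=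
  if h : ∃ v, IsOuterUnitNormal K z v then h.choose else 0

/-- The row vector `vᵀ x ∈ M_{1,m}(ℝ)`, for `v ∈ ℝⁿ` and `x ∈ M_{n,m}(ℝ)`. -/
def rowMul {n m : ℕ} (v : Vec n) (x : Mat n m) : Vec m :=
  WithLp.toLp 2 (Matrix.vecMul v.ofLp x)

/-- The function `h_{Π_{p,Q}K}` on `M_{n,m}(ℝ)`, with values in `[0, ∞]`:
`(∫_{∂^*K} h_Q(ν_K(z)ᵀ x)^p (z · ν_K(z))^{1-p} dℋ^{n-1}(z))^{1/p}`, with the Hausdorff measure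
in its standard normalization. -/
def projFn {n m : ℕ} (p : ℝ) (Q : Set (Vec m)) (K : Set (Vec n)) (x : Mat n m) : ℝ≥0∞ :=
  (∫⁻ z in regBoundary K,
    ENNReal.ofReal (supportFn Q (rowMul (gaussMap K z) x) ^ p *
      (inner ℝ z (gaussMap K z)) ^ (1 - p))
    ∂(Measure.euclideanHausdorffMeasure (n - 1) : Measure (Vec n))) ^ (1 / p)

/-- The `(L_p, Q)`-projection body `Π_{p,Q}K ⊆ M_{n,m}(ℝ)`, the set determined by
`h_{Π_{p,Q}K} ≥ 0`: all `y` with `x · y ≤ h_{Π_{p,Q}K}(x)` for every `x`. -/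
def projBody {n m : ℕ} (p : ℝ) (Q : Set (Vec m)) (K : Set (Vec n)) : Set (Mat n m) :=
  {y | ∀ x : Mat n m, ENNReal.ofReal (matInner x y) ≤ projFn p Q K x}

/-- Sublinearity of a `[0, ∞]`-valued function: subadditivity and positive homogeneity. -/
def IsSublinear {n m : ℕ} (h : Mat n m → ℝ≥0∞) : Prop :=
  (∀ x y, h (x + y) ≤ h x + h y) ∧
  ∀ (c : ℝ) (x : Mat n m), 0 ≤ c → h (c • x) = ENNReal.ofReal c * h x

/-- The image `φ K` of a subset of `ℝⁿ` under a matrix `φ`. -/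
def linImage {n : ℕ} (φ : Mat n n) (K : Set (Vec n)) : Set (Vec n) :=
  (fun z : Vec n => (WithLp.toLp 2 (φ.mulVec z.ofLp) : Vec n)) '' K

/-- The set `A L = {A y : y ∈ L}`, for a subset `L` of `M_{n,m}(ℝ)` and an `n × n` matrix `A`. -/
def mulImage {n m : ℕ} (A : Mat n n) (L : Set (Mat n m)) : Set (Mat n m) :=
  (fun y => A * y) '' L

end StarProj

end

/-! The proof replaces the boundary integral by a volume integral. Let `g` be the gauge of `K`, that
is, `1/ρ_K` off the origin: it is Lipschitz and positively homogeneous of degree 1, and its gradient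
is homogeneous of degree 0. At a regular boundary point `ν_K = ∇g/|∇g|`, and Euler's identity `z ·
∇g(z) = g(z) = 1` gives `z · ν_K = 1/|∇g|`. By homogeneity of `h_Q` the integrand is therefore
`|∇g|⁻¹ h_Q(∇gᵀx)^p`.

The measure `|∇g|⁻¹ dℋ^{n-1}` is `n` times the cone measure, the image of Lebesgue measure under
radial projection (`lintegral_regBoundary`). Hence `h(x)^p = n ∫_{g ≤ 1} h_Q(∇g(y)ᵀx)^p dy`
(`projFn_eq`). The cone measure formula is exact for flat pieces, by slicing. In general the
boundary is cut into countably many pieces on which `∇g` is nearly constant and `g` nearly affine;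
each is compared with a flat piece up to a factor that tends to 1.

The volume formula yields everything else. Finiteness holds because `∇g` is bounded, sublinearity is
Minkowski's inequality, and covariance under `GL(n)` is a change of variables, dilations of `K`
being scalar matrices. If `h(x) = 0` with `x ≠ 0`, then some `q ∈ Q` has `v = xq ≠ 0` and `∇g · v ≤
0` almost everywhere; so `g` does not increase along `v`, and `g(v) ≤ g(0) = 0` is a contradiction.
Finally, a positive finite sublinear function is the support function of its Wulff set, by
Hahn–Banach. -/

noncomputable section

/-! ### The gauge of a Lipschitz star body -/

namespace StarProj

/-- `g` is a Lipschitz gauge of `K`: a Lipschitz, positively homogeneous function, positive away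
from the origin, with `{g < 1} ⊆ K ⊆ {g ≤ 1}`. -/
structure IsLipGauge {n : ℕ} (K : Set (Vec n)) (g : Vec n → ℝ) : Prop where
  lip : ∃ C : NNReal, LipschitzWith C g
  map_smul : ∀ (t : ℝ) (x : Vec n), 0 ≤ t → g (t • x) = t * g x
  pos : ∀ x : Vec n, x ≠ 0 → 0 < g x
  mem_of_lt : ∀ x : Vec n, g x < 1 → x ∈ K
  le_of_mem : ∀ x ∈ K, g x ≤ 1

/-- Multiplied by `‖y‖`, the difference of directions is `(x - y) + (‖y‖ - ‖x‖) x/‖x‖`, and each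
summand has norm at most `‖x - y‖`. This carries a Lipschitz bound from the sphere to the
homogeneous extension. -/
theorem norm_mul_norm_normalize_sub_le {n : ℕ} (x y : Vec n) (hx : x ≠ 0) (hy : y ≠ 0) :
    ‖y‖ * ‖‖x‖⁻¹ • x - ‖y‖⁻¹ • y‖ ≤ 2 * ‖x - y‖ := by
  have hx' : 0 < ‖x‖ := norm_pos_iff.2 hx
  have hy' : 0 < ‖y‖ := norm_pos_iff.2 hy
  have e : ‖y‖ * ‖‖x‖⁻¹ • x - ‖y‖⁻¹ • y‖ = ‖(x - y) + ((‖y‖ - ‖x‖) * ‖x‖⁻¹) • x‖ := by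
    rw [← abs_of_pos hy', ← Real.norm_eq_abs, ← norm_smul, Real.norm_eq_abs, abs_of_pos hy']
    congr 1
    rw [smul_sub, smul_smul, smul_smul, mul_inv_cancel₀ hy'.ne', sub_mul,
      mul_inv_cancel₀ hx'.ne', sub_smul]
    module
  rw [e]
  refine (norm_add_le _ _).trans ?_
  rw [norm_smul, norm_mul, norm_inv, norm_norm, mul_assoc, inv_mul_cancel₀ hx'.ne', mul_one,
    Real.norm_eq_abs]
  have := abs_norm_sub_norm_le y x
  rw [norm_sub_rev] at this
  linarith

/-- The gauge is `‖x‖ / ρ_K(x/‖x‖)`. By compactness `ρ_K ≥ μ > 0` on the sphere, so `1/ρ_K` is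
Lipschitz there with constant `C/μ²`. Since `K` need not be closed, it is only squeezed between `{g
< 1}` and `{g ≤ 1}`. -/
theorem IsLipschitzStarBody.exists_lipGauge {n : ℕ} (hn : 1 ≤ n) {K : Set (Vec n)}
    (hK : IsLipschitzStarBody K) : ∃ g, IsLipGauge K g := by
  obtain ⟨⟨hstar, hpos, hcont⟩, C, hC⟩ := hK
  set S := Metric.sphere (0 : Vec n) 1 with hS
  have hSc : IsCompact S := isCompact_sphere _ _
  have : Nonempty (Fin n) := ⟨⟨0, hn⟩⟩
  have hSne : S.Nonempty := NormedSpace.sphere_nonempty.2 zero_le_one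
  obtain ⟨u₀, hu₀, hmin⟩ := hSc.exists_isMinOn hSne hcont
  set μ := radialFn K u₀ with hμ
  have hμ0 : 0 < μ := hpos u₀ hu₀
  have hle : ∀ u ∈ S, μ ≤ radialFn K u := fun u hu => hmin hu
  set r : Vec n → ℝ := fun u => (radialFn K u)⁻¹ with hr
  have hr_le : ∀ u ∈ S, r u ≤ μ⁻¹ := fun u hu => inv_anti₀ hμ0 (hle u hu)
  have hr_pos : ∀ u ∈ S, 0 < r u := fun u hu => inv_pos.2 (hpos u hu)
  have hr_lip : ∀ u ∈ S, ∀ v ∈ S, |r u - r v| ≤ C * (μ⁻¹ * μ⁻¹) * ‖u - v‖ := by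
    intro u hu v hv
    have h1 := hC.dist_le_mul u hu v hv
    rw [Real.dist_eq, dist_eq_norm] at h1
    have e : r u - r v = (r u * r v) * (radialFn K v - radialFn K u) := by
      have := (hpos u hu).ne'; have := (hpos v hv).ne'
      simp only [hr]; field_simp
    rw [e, abs_mul, abs_mul, abs_of_pos (hr_pos u hu), abs_of_pos (hr_pos v hv), abs_sub_comm]
    have h2 : r u * r v ≤ μ⁻¹ * μ⁻¹ :=
      mul_le_mul (hr_le u hu) (hr_le v hv) (hr_pos v hv).le (inv_nonneg.2 hμ0.le)
    calc r u * r v * |radialFn K u - radialFn K v| ≤ μ⁻¹ * μ⁻¹ * (C * ‖u - v‖) :=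
          mul_le_mul h2 h1 (abs_nonneg _) (by positivity)
      _ = _ := by ring
  have hdir : ∀ x : Vec n, x ≠ 0 → ‖x‖⁻¹ • x ∈ S := by
    intro x hx
    simp [hS, norm_smul, inv_mul_cancel₀ (norm_ne_zero_iff.2 hx)]
  have h0K : (0 : Vec n) ∈ K := by
    by_contra h0
    have hKe : K = ∅ := by
      by_contra hne
      obtain ⟨y, hy⟩ := Set.nonempty_iff_ne_empty.2 hne
      exact h0 (hstar.mem ⟨y, hy⟩)
    have := hpos u₀ hu₀
    simp [radialFn, hKe] at this
  -- An unbounded set has real supremum `0`, so positivity of the radial function also encodes its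
  -- finiteness.
  have hbdd : ∀ u ∈ S, BddAbove {l : ℝ | 0 ≤ l ∧ l • u ∈ K} := by
    intro u hu
    by_contra h
    have := hpos u hu
    rw [radialFn, Real.sSup_of_not_bddAbove h] at this
    exact lt_irrefl _ this
  set g : Vec n → ℝ := fun x => ‖x‖ * r (‖x‖⁻¹ • x) with hg
  have hgle : ∀ x, g x ≤ μ⁻¹ * ‖x‖ := by
    intro x
    rcases eq_or_ne x 0 with rfl | hx
    · simp [hg]
    · rw [mul_comm]
      exact mul_le_mul_of_nonneg_left (hr_le _ (hdir x hx)) (norm_nonneg _)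
  have hg0 : ∀ x, 0 ≤ g x := by
    intro x
    rcases eq_or_ne x 0 with rfl | hx
    · simp [hg]
    · exact mul_nonneg (norm_nonneg _) (hr_pos _ (hdir x hx)).le
  refine ⟨g, ?_, ?_, ?_, ?_, ?_⟩
  · refine ⟨⟨μ⁻¹ + C * (μ⁻¹ * μ⁻¹) * 2, by positivity⟩, LipschitzWith.of_dist_le_mul ?_⟩
    intro x y
    rw [Real.dist_eq, dist_eq_norm]
    change _ ≤ (μ⁻¹ + C * (μ⁻¹ * μ⁻¹) * 2) * ‖x - y‖
    have hCn : 0 ≤ C * (μ⁻¹ * μ⁻¹) * 2 * ‖x - y‖ := by positivity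
    rcases eq_or_ne x 0 with rfl | hx
    · have h0 : g 0 = 0 := by simp [hg]
      rw [h0, zero_sub, abs_neg, abs_of_nonneg (hg0 y), zero_sub, norm_neg] at *
      nlinarith [hgle y]
    rcases eq_or_ne y 0 with rfl | hy
    · have h0 : g 0 = 0 := by simp [hg]
      rw [h0, sub_zero, abs_of_nonneg (hg0 x), sub_zero] at *
      nlinarith [hgle x]
    have hu := hdir x hx
    have hv := hdir y hy
    have e : g x - g y = (‖x‖ - ‖y‖) * r (‖x‖⁻¹ • x)
        + ‖y‖ * (r (‖x‖⁻¹ • x) - r (‖y‖⁻¹ • y)) := by simp only [hg]; ring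
    rw [e]
    refine (abs_add_le _ _).trans ?_
    rw [abs_mul, abs_mul, abs_of_pos (hr_pos _ hu), abs_of_nonneg (norm_nonneg y)]
    have h1 : |‖x‖ - ‖y‖| * r (‖x‖⁻¹ • x) ≤ ‖x - y‖ * μ⁻¹ :=
      mul_le_mul (abs_norm_sub_norm_le x y) (hr_le _ hu) (hr_pos _ hu).le (norm_nonneg _)
    have h2 : ‖y‖ * |r (‖x‖⁻¹ • x) - r (‖y‖⁻¹ • y)| ≤ C * (μ⁻¹ * μ⁻¹) * (2 * ‖x - y‖) := by
      calc _ ≤ ‖y‖ * (C * (μ⁻¹ * μ⁻¹) * ‖‖x‖⁻¹ • x - ‖y‖⁻¹ • y‖) :=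
            mul_le_mul_of_nonneg_left (hr_lip _ hu _ hv) (norm_nonneg _)
        _ = C * (μ⁻¹ * μ⁻¹) * (‖y‖ * ‖‖x‖⁻¹ • x - ‖y‖⁻¹ • y‖) := by ring
        _ ≤ _ := mul_le_mul_of_nonneg_left (norm_mul_norm_normalize_sub_le x y hx hy)
            (by positivity)
    linarith
  · intro t x ht
    rcases ht.eq_or_lt with rfl | ht
    · simp [hg]
    simp only [hg, norm_smul, Real.norm_eq_abs, abs_of_pos ht]
    rw [mul_assoc, smul_smul, mul_inv_rev, mul_assoc, inv_mul_cancel₀ ht.ne', mul_one]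
  · intro x hx
    exact mul_pos (norm_pos_iff.2 hx) (hr_pos _ (hdir x hx))
  · intro x hx1
    rcases eq_or_ne x 0 with rfl | hx
    · exact h0K
    have hu := hdir x hx
    have hx' : 0 < ‖x‖ := norm_pos_iff.2 hx
    have hlt : ‖x‖ < radialFn K (‖x‖⁻¹ • x) := by
      have : ‖x‖ * (radialFn K (‖x‖⁻¹ • x))⁻¹ < 1 := hx1
      rwa [← div_eq_mul_inv, div_lt_one (hpos _ hu)] at this
    obtain ⟨l, ⟨hl0, hl⟩, hlx⟩ := exists_lt_of_lt_csSup
      ⟨0, by simpa using h0K⟩ hlt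
    have hl' : 0 < l := hx'.trans hlx
    have := hstar.smul_mem hl (t := ‖x‖ / l) (by positivity) ((div_le_one hl').2 hlx.le)
    rwa [smul_smul, smul_smul, div_mul_cancel₀ _ hl'.ne', mul_inv_cancel₀ hx'.ne', one_smul] at this
  · intro x hxK
    rcases eq_or_ne x 0 with rfl | hx
    · simp [hg]
    have hu := hdir x hx
    have hx' : 0 < ‖x‖ := norm_pos_iff.2 hx
    have : ‖x‖ ≤ radialFn K (‖x‖⁻¹ • x) := by
      refine le_csSup (hbdd _ hu) ⟨hx'.le, ?_⟩
      rwa [smul_smul, mul_inv_cancel₀ hx'.ne', one_smul]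
    change ‖x‖ * (radialFn K (‖x‖⁻¹ • x))⁻¹ ≤ 1
    rwa [← div_eq_mul_inv, div_le_one (hpos _ hu)]

/-! ### Boundary, regular points and Gauss map in terms of the gauge -/

namespace IsLipGauge

variable {n : ℕ} {K : Set (Vec n)} {g : Vec n → ℝ}

theorem continuous (h : IsLipGauge K g) : Continuous g := h.lip.choose_spec.continuous

theorem map_zero (h : IsLipGauge K g) : g 0 = 0 := by
  simpa using h.map_smul 0 0 le_rfl

theorem nonneg (h : IsLipGauge K g) (x : Vec n) : 0 ≤ g x := by
  rcases eq_or_ne x 0 with rfl | hx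
  · exact h.map_zero.ge
  · exact (h.pos x hx).le

theorem ne_zero_of_eq_one (h : IsLipGauge K g) {x : Vec n} (hx : g x = 1) : x ≠ 0 := by
  rintro rfl
  rw [h.map_zero] at hx
  exact zero_ne_one hx

theorem radialFn_eq (h : IsLipGauge K g) {x : Vec n} (hx : x ≠ 0) : radialFn K x = (g x)⁻¹ := by
  have hgx := h.pos x hx
  refine IsLUB.csSup_eq ⟨?_, ?_⟩ ⟨0, le_rfl, h.mem_of_lt _ (by simp [h.map_zero])⟩
  · rintro l ⟨hl, hlK⟩
    have := h.le_of_mem _ hlK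
    rw [h.map_smul _ _ hl] at this
    rwa [← one_div, le_div_iff₀ hgx]
  · intro b hb
    refine le_of_forall_lt_imp_le_of_dense fun l hl => ?_
    rcases lt_or_ge l 0 with h0 | h0
    · exact h0.le.trans (hb ⟨le_rfl, h.mem_of_lt _ (by simp [h.map_zero])⟩)
    · refine hb ⟨h0, h.mem_of_lt _ ?_⟩
      rw [h.map_smul _ _ h0]
      rwa [← one_div, lt_div_iff₀ hgx] at hl

theorem frontier_eq (h : IsLipGauge K g) : frontier K = {x | g x = 1} := by
  have hint : {x | g x < 1} ⊆ interior K :=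
    interior_maximal h.mem_of_lt (isOpen_lt h.continuous continuous_const)
  have hcl : closure K ⊆ {x | g x ≤ 1} :=
    closure_minimal h.le_of_mem (isClosed_le h.continuous continuous_const)
  ext z
  constructor
  · rintro ⟨h1, h2⟩
    exact le_antisymm (hcl h1) (not_lt.1 fun hlt => h2 (hint hlt))
  · intro hz
    have hz : g z = 1 := hz
    have hc : Continuous fun t : ℝ => t • z := by fun_prop
    have h1 : Tendsto (fun t : ℝ => t • z) (𝓝 1) (𝓝 z) := by simpa using hc.tendsto 1
    refine ⟨mem_closure_of_tendsto (h1.mono_left (nhdsWithin_le_nhds (s := Set.Iio 1))) ?_, ?_⟩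
    · filter_upwards [self_mem_nhdsWithin, nhdsWithin_le_nhds (lt_mem_nhds zero_lt_one)] with t ht ht0
      refine h.mem_of_lt _ ?_
      rw [h.map_smul _ _ (le_of_lt ht0), hz, mul_one]
      exact ht
    · intro hi
      have h2 := (h1.mono_left (nhdsWithin_le_nhds (s := Set.Ioi 1))).eventually
        (mem_interior_iff_mem_nhds.1 hi)
      obtain ⟨t, ht, ht1⟩ := (h2.and self_mem_nhdsWithin).exists
      have ht1 : 1 < t := ht1
      have := h.le_of_mem _ ht
      rw [h.map_smul _ _ (by linarith), hz] at this
      linarith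

theorem radialFn_eventuallyEq (h : IsLipGauge K g) {x : Vec n} (hx : x ≠ 0) :
    radialFn K =ᶠ[𝓝 x] fun y => (g y)⁻¹ := by
  filter_upwards [isOpen_ne.mem_nhds hx] with y hy using h.radialFn_eq hy

theorem differentiableAt_radialFn_iff (h : IsLipGauge K g) {x : Vec n} (hx : x ≠ 0) :
    DifferentiableAt ℝ (radialFn K) x ↔ DifferentiableAt ℝ g x := by
  have hgx := h.pos x hx
  rw [(h.radialFn_eventuallyEq hx).differentiableAt_iff]
  refine ⟨fun hd => ?_, fun hd => hd.fun_inv hgx.ne'⟩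
  have := hd.fun_inv (inv_ne_zero hgx.ne')
  simpa using this

theorem regBoundary_eq (h : IsLipGauge K g) :
    regBoundary K = {z | g z = 1 ∧ DifferentiableAt ℝ g z} := by
  ext z
  rw [regBoundary, Set.mem_ofPred_eq, h.frontier_eq]
  exact and_congr_right fun hz => h.differentiableAt_radialFn_iff (h.ne_zero_of_eq_one hz)

theorem measurableSet_regBoundary (h : IsLipGauge K g) : MeasurableSet (regBoundary K) := by
  rw [h.regBoundary_eq]
  exact (isClosed_eq h.continuous continuous_const).measurableSet.inter
    (measurableSet_of_differentiableAt ℝ g)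

/-- Euler's identity: differentiate `g((1 + t)x) = (1 + t) g(x)` at `t = 0`. -/
theorem fderiv_self (h : IsLipGauge K g) {x : Vec n} (hd : DifferentiableAt ℝ g x) :
    fderiv ℝ g x x = g x := by
  have h1 : HasDerivAt (fun t : ℝ => g (x + t • x)) (fderiv ℝ g x x) 0 :=
    hd.hasFDerivAt.hasLineDerivAt x
  have h2 : HasDerivAt (fun t : ℝ => (1 + t) * g x) (1 * g x) 0 :=
    ((hasDerivAt_id (0 : ℝ)).const_add 1).mul_const (g x)
  have he : (fun t : ℝ => g (x + t • x)) =ᶠ[𝓝 0] fun t => (1 + t) * g x := by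
    filter_upwards [lt_mem_nhds (show (-1 : ℝ) < 0 by norm_num)] with t ht
    rw [← h.map_smul _ _ (by linarith), add_smul, one_smul]
  simpa using h1.unique (h2.congr_of_eventuallyEq he)

theorem fderiv_smul (h : IsLipGauge K g) {t : ℝ} (ht : 0 < t) (x : Vec n) :
    fderiv ℝ g (t • x) = fderiv ℝ g x := by
  let := invertibleOfNonzero ht.ne'
  have e : g = t • fun y => g (t⁻¹ • y) := by
    ext y
    rw [Pi.smul_apply, smul_eq_mul, h.map_smul _ _ (by positivity), mul_inv_cancel_left₀ ht.ne']
  conv_lhs => rw [e]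
  -- These rules need no differentiability, so the identity also covers points where both
  -- derivatives take the default value `0`.
  rw [fderiv_const_smul_of_invertible, fderiv_comp_smul, inv_smul_smul₀ ht.ne', smul_smul,
    mul_inv_cancel₀ ht.ne', one_smul]

theorem inner_gradient_self (h : IsLipGauge K g) {x : Vec n} (hd : DifferentiableAt ℝ g x) :
    inner ℝ (gradient g x) x = g x := by
  rw [← h.fderiv_self hd, gradient, InnerProductSpace.toDual_symm_apply]

theorem gradient_smul (h : IsLipGauge K g) {t : ℝ} (ht : 0 < t) (x : Vec n) :
    gradient g (t • x) = gradient g x := by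
  rw [gradient, gradient, h.fderiv_smul ht]

theorem measurable_gradient (g : Vec n → ℝ) : Measurable (gradient g) :=
  (LinearIsometryEquiv.continuous _).measurable.comp (measurable_fderiv ℝ g)

/-- The first-order expansion of `g` at `z`, where `g z = 1`, compared with `{g < 1} ⊆ K ⊆ {g ≤ 1}`,
shows that the normalized gradient is an outer normal; uniqueness identifies it with the chosen one.
-/
theorem gaussMap_eq (h : IsLipGauge K g) {z : Vec n} (hz : z ∈ regBoundary K) :
    gaussMap K z = ‖gradient g z‖⁻¹ • gradient g z := by
  rw [h.regBoundary_eq] at hz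
  obtain ⟨hz1, hd⟩ := hz
  set w := gradient g z with hw
  have hw0 : 0 < ‖w‖ := by
    rw [norm_pos_iff]
    intro h0
    have := h.inner_gradient_self hd
    rw [← hw, h0, inner_zero_left, hz1] at this
    exact zero_ne_one this
  have hN : IsOuterUnitNormal K z (‖w‖⁻¹ • w) := by
    refine ⟨by rw [norm_smul, norm_inv, norm_norm, inv_mul_cancel₀ hw0.ne'], fun ε hε => ?_⟩
    have hlo := hd.hasFDerivAt.isLittleO.def (mul_pos hε hw0)
    filter_upwards [hlo] with y hy
    have e : fderiv ℝ g z (y - z) = ‖w‖ * inner ℝ (‖w‖⁻¹ • w) (y - z) := by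
      rw [inner_smul_left, conj_trivial, mul_inv_cancel_left₀ hw0.ne', hw, gradient,
        InnerProductSpace.toDual_symm_apply]
    rw [e, hz1, Real.norm_eq_abs, abs_le] at hy
    refine ⟨fun hyK => ?_, fun hyK => ?_⟩
    · have := h.le_of_mem y hyK
      nlinarith [norm_nonneg (y - z)]
    · have : 1 ≤ g y := not_lt.1 fun hlt => hyK (h.mem_of_lt y hlt)
      nlinarith [norm_nonneg (y - z)]
  have hex : ∃ v, IsOuterUnitNormal K z v := ⟨_, hN⟩
  rw [gaussMap, dif_pos hex]
  exact hex.choose_spec.unique hN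

end IsLipGauge

/-! ### Volumes of cones over flat and nearly flat pieces -/

/-- The volume of a cone of height `1` in `ℝⁿ` over a base of unit `(n - 1)`-volume. -/
def coneConst (n : ℕ) : ℝ≥0∞ := ∫⁻ t in Set.Ioc (0 : ℝ) 1, ENNReal.ofReal (t ^ (n - 1))

theorem coneConst_ne_top (n : ℕ) : coneConst n ≠ ⊤ := by
  refine ne_top_of_le_ne_top ENNReal.one_ne_top ?_
  calc coneConst n ≤ ∫⁻ t in Set.Ioc (0 : ℝ) 1, 1 := by
        refine setLIntegral_mono measurable_const fun t ht => ?_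
        rw [ENNReal.ofReal_le_one]
        exact pow_le_one₀ ht.1.le ht.2
    _ = 1 := by simp

theorem coneConst_ne_zero (n : ℕ) : coneConst n ≠ 0 := by
  rw [coneConst, Ne, lintegral_eq_zero_iff (by fun_prop)]
  intro h
  have h2 : ∀ᵐ t ∂volume.restrict (Set.Ioc (0 : ℝ) 1), False := by
    filter_upwards [h, ae_restrict_mem measurableSet_Ioc] with t ht ht'
    have : 0 < t ^ (n - 1) := pow_pos ht'.1 _
    simp only [Pi.zero_apply, ENNReal.ofReal_eq_zero] at ht
    linarith
  have h3 := h2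
  rw [eventually_false_iff_eq_bot, ae_eq_bot, Measure.restrict_eq_zero] at h3
  simp at h3

/-- Fubini in the direction of `w`: the slice of a cone at height `t` is `t` times the slice at
height 1, so its measure carries the factor `t ^ (n - 1)`. -/
theorem volume_cone_inter_slab {n : ℕ} {S : Set (Vec n)} (hSm : MeasurableSet S)
    (hS : ∀ (t : ℝ) (x : Vec n), 0 < t → (t • x ∈ S ↔ x ∈ S)) {w : Vec n} (hw : w ≠ 0) :
    volume (S ∩ {x | 0 < inner ℝ w x ∧ inner ℝ w x ≤ 1}) =
      ENNReal.ofReal ‖w‖⁻¹ * (coneConst n *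
        (Measure.euclideanHausdorffMeasure (n - 1) : Measure (Vec n))
          (S ∩ {x | inner ℝ w x = 1})) := by
  have hw0 : 0 < ‖w‖ := norm_pos_iff.2 hw
  set T := S ∩ {x : Vec n | 0 < inner ℝ w x ∧ inner ℝ w x ≤ 1} with hT
  have hTm : MeasurableSet T := by
    have hm : Measurable fun x : Vec n => (inner ℝ w x : ℝ) := by fun_prop
    exact hSm.inter ((measurableSet_lt measurable_const hm).inter
      (measurableSet_le hm measurable_const))
  -- With this scaling `w · (t v) = t`, so the slice through `t v` is `{w · y = t}`; the factor
  -- `‖w‖⁻¹` is `‖v‖`.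
  set v : Vec n := (‖w‖ ^ 2)⁻¹ • w with hv
  have hv0 : v ≠ 0 := smul_ne_zero (by positivity) hw
  have hvn : ‖v‖ₑ = ENNReal.ofReal ‖w‖⁻¹ := by
    rw [← ofReal_norm, hv, norm_smul, norm_inv, norm_pow, norm_norm]
    congr 1
    field_simp
  have key := EuclideanGeometry.euclideanHausdorffMeasure_eq_lintegral (0 : Vec n) hv0 hTm
  rw [InnerProductSpace.euclideanHausdorffMeasure_eq_volume, hvn] at key
  rw [key]
  congr 1
  have hfr : Module.finrank ℝ (Vec n) = n := by simp
  have hslice : ∀ (x : ℝ) (y : Vec n),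
      y ∈ AffineSubspace.mk' (x • v +ᵥ (0 : Vec n)) (Submodule.span ℝ {v})ᗮ ↔ inner ℝ w y = x := by
    intro x y
    rw [AffineSubspace.mem_mk', Submodule.mem_orthogonal_singleton_iff_inner_right, vsub_eq_sub,
      vadd_eq_add, add_zero, inner_sub_right, hv, inner_smul_left, inner_smul_right,
      inner_smul_left, inner_smul_right, real_inner_self_eq_norm_sq, conj_trivial,
      inv_mul_cancel₀ (by positivity), mul_one, mul_comm x, ← mul_sub, mul_eq_zero, sub_eq_zero]
    simp [hw]
  have hint : ∀ x : ℝ, (Measure.euclideanHausdorffMeasure (Module.finrank ℝ (Vec n) - 1) :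
      Measure (Vec n)) (T ∩ AffineSubspace.mk' (x • v +ᵥ (0 : Vec n)) (Submodule.span ℝ {v})ᗮ) =
      (Set.Ioc (0 : ℝ) 1).indicator (fun t => ENNReal.ofReal (t ^ (n - 1)) *
        (Measure.euclideanHausdorffMeasure (n - 1) : Measure (Vec n))
          (S ∩ {x | inner ℝ w x = 1})) x := by
    intro x
    rw [hfr]
    by_cases hx : x ∈ Set.Ioc (0 : ℝ) 1
    · have hx0 : 0 < x := hx.1
      rw [Set.indicator_of_mem hx]
      have : T ∩ AffineSubspace.mk' (x • v +ᵥ (0 : Vec n)) (Submodule.span ℝ {v})ᗮ =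
          x • (S ∩ {x | inner ℝ w x = 1}) := by
        ext y
        rw [Set.mem_smul_set_iff_inv_smul_mem₀ hx0.ne']
        simp only [Set.mem_inter_iff, SetLike.mem_coe, hslice, hT, Set.mem_ofPred_eq,
          inner_smul_right, hS _ y (inv_pos.2 hx0)]
        constructor
        · rintro ⟨⟨h1, -⟩, h2⟩
          exact ⟨h1, by rw [h2, inv_mul_cancel₀ hx0.ne']⟩
        · rintro ⟨h1, h2⟩
          have h2 : inner ℝ w y = x := by rwa [inv_mul_eq_one₀ hx0.ne', eq_comm] at h2
          exact ⟨⟨h1, by rw [h2]; exact hx⟩, h2⟩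
      rw [this, Measure.euclideanHausdorffMeasure_smul₀ _ hx0.ne', ENNReal.smul_def, smul_eq_mul]
      congr 1
      rw [ENNReal.coe_pow, ENNReal.ofReal_pow hx0.le]
      congr 1
      rw [← enorm_eq_nnnorm, Real.enorm_eq_ofReal hx0.le]
    · rw [Set.indicator_of_notMem hx]
      suffices T ∩ AffineSubspace.mk' (x • v +ᵥ (0 : Vec n)) (Submodule.span ℝ {v})ᗮ = ∅ by
        rw [this, measure_empty]
      ext y
      simp only [Set.mem_inter_iff, SetLike.mem_coe, hslice, hT, Set.mem_ofPred_eq,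
        Set.mem_empty_iff_false, iff_false]
      rintro ⟨⟨-, h1⟩, h2⟩
      exact hx (h2 ▸ h1)
  simp_rw [hint]
  rw [lintegral_indicator measurableSet_Ioc, lintegral_mul_const _ (by fun_prop), coneConst]

/-- Make the cover disjoint, sum the local inequalities, and let `θ` decrease to 1. -/
theorem measure_le_of_forall_countable_cover {X : Type*} [MeasurableSpace X] {μ ν : Measure X}
    {s : Set X} {N : ℕ}
    (h : ∀ θ : ℝ, 1 < θ → ∃ t : ℕ → Set X, (∀ i, MeasurableSet (t i)) ∧ s ⊆ ⋃ i, t i ∧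
      ∀ i, ∀ A ⊆ s ∩ t i, MeasurableSet A → μ A ≤ ENNReal.ofReal (θ ^ N) * ν A)
    {A : Set X} (hA : MeasurableSet A) (hAs : A ⊆ s) : μ A ≤ ν A := by
  have h1 : ∀ θ : ℝ, 1 < θ → μ A ≤ ENNReal.ofReal (θ ^ N) * ν A := by
    intro θ hθ
    obtain ⟨t, htm, hst, ht⟩ := h θ hθ
    have hdm : ∀ i, MeasurableSet (disjointed t i) := fun i => MeasurableSet.disjointed htm i
    have e : A = ⋃ i, A ∩ disjointed t i := by
      rw [← Set.inter_iUnion, iUnion_disjointed, Set.inter_eq_left.2 (hAs.trans hst)]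
    have hd : Pairwise (Function.onFun Disjoint fun i => A ∩ disjointed t i) := fun i j hij =>
      (disjoint_disjointed t hij).mono Set.inter_subset_right Set.inter_subset_right
    conv_lhs => rw [e]
    conv_rhs => rw [e]
    rw [measure_iUnion hd fun i => hA.inter (hdm i), measure_iUnion hd fun i => hA.inter (hdm i),
      ← ENNReal.tsum_mul_left]
    exact ENNReal.tsum_le_tsum fun i => ht i _
      (Set.inter_subset_inter hAs (disjointed_subset t i)) (hA.inter (hdm i))
  have hc : Continuous fun θ : ℝ => ENNReal.ofReal (θ ^ N) :=
    ENNReal.continuous_ofReal.comp (continuous_pow N)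
  have h2 : Tendsto (fun θ : ℝ => ENNReal.ofReal (θ ^ N) * ν A) (𝓝[>] 1) (𝓝 (1 * ν A)) := by
    refine ENNReal.Tendsto.mul_const ?_ (Or.inl one_ne_zero)
    have := (hc.tendsto 1).mono_left (nhdsWithin_le_nhds (s := Set.Ioi 1))
    simpa using this
  rw [one_mul] at h2
  exact ge_of_tendsto h2 (by filter_upwards [self_mem_nhdsWithin] with θ hθ using h1 θ hθ)

theorem euclideanHausdorffMeasure_image_le {X Y : Type*} [EMetricSpace X] [MeasurableSpace X]
    [BorelSpace X] [EMetricSpace Y] [MeasurableSpace Y] [BorelSpace Y] {C : NNReal} {f : X → Y}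
    {s : Set X} (hf : LipschitzOnWith C f s) (d : ℕ) :
    (Measure.euclideanHausdorffMeasure d : Measure Y) (f '' s) ≤
      (C : ℝ≥0∞) ^ d * (Measure.euclideanHausdorffMeasure d : Measure X) s := by
  rw [Measure.euclideanHausdorffMeasure_def, Measure.euclideanHausdorffMeasure_def,
    Measure.smul_apply, Measure.smul_apply, ENNReal.smul_def, ENNReal.smul_def, smul_eq_mul,
    smul_eq_mul, mul_left_comm]
  gcongr
  simpa using hf.hausdorffMeasure_image_le (d := (d : ℝ)) (by positivity)

/-- The radial projection onto the hypersurface `{g = 1}`. -/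
def radialProj {n : ℕ} (g : Vec n → ℝ) (x : Vec n) : Vec n := (g x)⁻¹ • x

/-- The union of the open rays from the origin through the points of `A ⊆ {g = 1}`. -/
def openCone {n : ℕ} (g : Vec n → ℝ) (A : Set (Vec n)) : Set (Vec n) :=
  {x | x ≠ 0 ∧ radialProj g x ∈ A}

/-- Radial projection `z ↦ z / (w · z)` to the plane `{w · x = 1}` is nearly isometric on a nearly
flat piece: the scaling factors are close to 1, and their variation times `‖y‖` is of order `δ ‖z -
y‖`. -/
theorem norm_sub_le_of_flat {n : ℕ} {w z y : Vec n} {M δ : ℝ} (hδ : 0 ≤ δ)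
    (hδ2 : δ < 1 / 2) (hy : ‖y‖ ≤ M)
    (haz : |inner ℝ w z - 1| ≤ δ) (hay : |inner ℝ w y - 1| ≤ δ)
    (hflat : |inner ℝ w (z - y)| * M ≤ δ * ‖z - y‖) :
    ‖(inner ℝ w z : ℝ)⁻¹ • z - (inner ℝ w y : ℝ)⁻¹ • y‖ ≤ ((1 - 2 * δ)⁻¹) ^ 2 * ‖z - y‖ ∧
    ‖z - y‖ ≤ ((1 - 2 * δ)⁻¹) ^ 2 * ‖(inner ℝ w z : ℝ)⁻¹ • z - (inner ℝ w y : ℝ)⁻¹ • y‖ := by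
  rw [inner_sub_right] at hflat
  set a : ℝ := inner ℝ w z
  set b : ℝ := inner ℝ w y
  obtain ⟨ha1, ha2⟩ := abs_le.1 haz
  obtain ⟨hb1, hb2⟩ := abs_le.1 hay
  have ha : 0 < a := by linarith
  have hb : 0 < b := by linarith
  have hd1 : 0 < 1 - δ := by linarith
  have hd2 : 0 < 1 - 2 * δ := by linarith
  set D := ‖z - y‖
  set D' := ‖a⁻¹ • z - b⁻¹ • y‖
  have hD : 0 ≤ D := norm_nonneg _
  have hD' : 0 ≤ D' := norm_nonneg _
  have hθ : (1 - δ)⁻¹ ≤ (1 - 2 * δ)⁻¹ := inv_anti₀ hd2 (by linarith)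
  have hθ1 : 1 ≤ (1 - 2 * δ)⁻¹ := (one_le_inv₀ hd2).2 (by linarith)
  have hai : a⁻¹ ≤ (1 - δ)⁻¹ := inv_anti₀ hd1 (by linarith)
  have hbi : b⁻¹ ≤ (1 - δ)⁻¹ := inv_anti₀ hd1 (by linarith)
  have hyab : |a - b| * ‖y‖ ≤ δ * D :=
    (mul_le_mul_of_nonneg_left hy (abs_nonneg _)).trans hflat
  constructor
  · have e : a⁻¹ • z - b⁻¹ • y = a⁻¹ • (z - y) - (a⁻¹ * b⁻¹ * (a - b)) • y := by
      have : a⁻¹ * b⁻¹ * (a - b) = b⁻¹ - a⁻¹ := by field_simp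
      rw [this]; module
    have h1 : D' ≤ a⁻¹ * D + a⁻¹ * b⁻¹ * (|a - b| * ‖y‖) := by
      simp only [D', e]
      refine (norm_sub_le _ _).trans ?_
      rw [norm_smul, norm_smul, Real.norm_eq_abs, Real.norm_eq_abs, abs_mul, abs_mul,
        abs_of_pos (inv_pos.2 ha), abs_of_pos (inv_pos.2 hb), mul_assoc (a⁻¹ * b⁻¹)]
    have h2 : a⁻¹ * b⁻¹ * (|a - b| * ‖y‖) ≤ (1 - δ)⁻¹ * (1 - δ)⁻¹ * (δ * D) := by
      gcongr
    have h3 : a⁻¹ * D ≤ (1 - δ)⁻¹ * D := by gcongr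
    have h4 : (1 - δ)⁻¹ * D + (1 - δ)⁻¹ * (1 - δ)⁻¹ * (δ * D) = ((1 - δ)⁻¹) ^ 2 * D := by
      field_simp; ring
    have h5 : ((1 - δ)⁻¹) ^ 2 * D ≤ ((1 - 2 * δ)⁻¹) ^ 2 * D := by gcongr
    linarith
  · have e : z - y = a • (a⁻¹ • z - b⁻¹ • y) + ((a - b) * b⁻¹) • y := by
      rw [smul_sub, smul_smul, smul_smul, mul_inv_cancel₀ ha.ne', sub_mul, mul_inv_cancel₀ hb.ne']
      module
    have h1 : D ≤ a * D' + b⁻¹ * (|a - b| * ‖y‖) := by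
      simp only [D, D']
      conv_lhs => rw [e]
      refine (norm_add_le _ _).trans ?_
      rw [norm_smul, norm_smul, Real.norm_eq_abs, Real.norm_eq_abs, abs_mul,
        abs_of_pos ha, abs_of_pos (inv_pos.2 hb)]
      exact (by ring : _ = _).le
    have h2 : b⁻¹ * (|a - b| * ‖y‖) ≤ (1 - δ)⁻¹ * (δ * D) := by gcongr
    have h3 : a * D' ≤ (1 + δ) * D' := by gcongr; linarith
    have h4 : D ≤ (1 + δ) * D' + (1 - δ)⁻¹ * (δ * D) := by linarith
    have h5 : (1 - δ) * D ≤ (1 + δ) * (1 - δ) * D' + δ * D := by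
      have := mul_le_mul_of_nonneg_left h4 hd1.le
      rw [mul_add, mul_inv_cancel_left₀ hd1.ne'] at this
      linarith
    have h6 : (1 - 2 * δ) * D ≤ D' := by nlinarith [mul_nonneg (mul_self_nonneg δ) hD']
    calc D = (1 - 2 * δ)⁻¹ * ((1 - 2 * δ) * D) := by rw [inv_mul_cancel_left₀ hd2.ne']
      _ ≤ (1 - 2 * δ)⁻¹ * D' := by gcongr
      _ ≤ ((1 - 2 * δ)⁻¹) ^ 2 * D' := by
        gcongr
        exact le_self_pow₀ hθ1 two_ne_zero

namespace IsLipGauge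

variable {n : ℕ} {K : Set (Vec n)} {g : Vec n → ℝ}

theorem measurable_radialProj (h : IsLipGauge K g) : Measurable (radialProj g) :=
  (h.continuous.measurable.inv).smul measurable_id

theorem radialProj_smul (h : IsLipGauge K g) {t : ℝ} (ht : 0 < t) (x : Vec n) :
    radialProj g (t • x) = radialProj g x := by
  rw [radialProj, radialProj, h.map_smul _ _ ht.le, smul_smul, mul_inv, mul_right_comm,
    inv_mul_cancel₀ ht.ne', one_mul]

theorem smul_radialProj (h : IsLipGauge K g) {x : Vec n} (hx : x ≠ 0) :
    g x • radialProj g x = x := by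
  rw [radialProj, smul_smul, mul_inv_cancel₀ (h.pos x hx).ne', one_smul]

theorem gauge_radialProj (h : IsLipGauge K g) {x : Vec n} (hx : x ≠ 0) :
    g (radialProj g x) = 1 := by
  rw [radialProj, h.map_smul _ _ (inv_nonneg.2 (h.nonneg x)), inv_mul_cancel₀ (h.pos x hx).ne']

theorem radialProj_of_eq_one {x : Vec n} (hx : g x = 1) : radialProj g x = x := by
  rw [radialProj, hx, inv_one, one_smul]

theorem measurableSet_openCone (h : IsLipGauge K g) {A : Set (Vec n)} (hA : MeasurableSet A) :
    MeasurableSet (openCone g A) :=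
  (measurableSet_singleton (0 : Vec n)).compl.inter (h.measurable_radialProj hA)

theorem smul_mem_openCone (h : IsLipGauge K g) {A : Set (Vec n)} {t : ℝ} (ht : 0 < t)
    (x : Vec n) : t • x ∈ openCone g A ↔ x ∈ openCone g A := by
  simp only [openCone, Set.mem_ofPred_eq, h.radialProj_smul ht, ne_eq, smul_eq_zero, ht.ne',
    false_or]

theorem volume_openCone_inter_le (h : IsLipGauge K g) (A : Set (Vec n)) {s : ℝ} (hs : 0 < s) :
    volume (openCone g A ∩ {x | g x ≤ s}) =
      ENNReal.ofReal s ^ n * volume (openCone g A ∩ {x | g x ≤ 1}) := by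
  have e : openCone g A ∩ {x | g x ≤ s} = s • (openCone g A ∩ {x | g x ≤ 1}) := by
    ext x
    rw [Set.mem_smul_set_iff_inv_smul_mem₀ hs.ne']
    simp only [Set.mem_inter_iff, h.smul_mem_openCone (inv_pos.2 hs), Set.mem_ofPred_eq,
      h.map_smul _ _ (inv_pos.2 hs).le]
    rw [inv_mul_le_iff₀ hs, mul_one]
  rw [e, Measure.addHaar_smul, abs_of_nonneg (by positivity), ← ENNReal.ofReal_pow hs.le]
  simp

/-- The piece `A` is replaced by the section of its cone with the plane `{w · x = 1}`, where the
volume is known exactly. Writing `θ = (1 - 2δ)⁻¹`, exchanging `‖∇g‖` for `‖w‖` costs `θ`, exchanging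
Hausdorff measures costs `θ ^ (2(n - 1))`, and exchanging `{g ≤ 1}` for the slab costs `θ ^ n`. -/
theorem cone_comparison (h : IsLipGauge K g) {M : ℝ} (hM0 : 0 < M)
    (hM : ∀ z, g z = 1 → ‖z‖ ≤ M) {δ : ℝ} (hδ : 0 < δ) (hδ2 : δ < 1 / 2) {w : Vec n}
    {A : Set (Vec n)} (hA : MeasurableSet A) (hAr : A ⊆ regBoundary K)
    (hw : ∀ z ∈ A, ‖gradient g z - w‖ * M ≤ δ)
    (hflat : ∀ z ∈ A, ∀ y ∈ A, |inner ℝ w (z - y)| * M ≤ δ * ‖z - y‖) :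
    coneConst n * ∫⁻ z in A, ENNReal.ofReal ‖gradient g z‖⁻¹
        ∂(Measure.euclideanHausdorffMeasure (n - 1) : Measure (Vec n)) ≤
      ENNReal.ofReal (((1 - 2 * δ)⁻¹) ^ (3 * n + 1)) *
        volume (openCone g A ∩ {x | g x ≤ 1}) ∧
    volume (openCone g A ∩ {x | g x ≤ 1}) ≤
      ENNReal.ofReal (((1 - 2 * δ)⁻¹) ^ (3 * n + 1)) *
        (coneConst n * ∫⁻ z in A, ENNReal.ofReal ‖gradient g z‖⁻¹
          ∂(Measure.euclideanHausdorffMeasure (n - 1) : Measure (Vec n))) := by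
  rcases A.eq_empty_or_nonempty with rfl | ⟨z₀, hz₀⟩
  · simp [openCone]
  rw [h.regBoundary_eq] at hAr
  have hd2 : 0 < 1 - 2 * δ := by linarith
  set θ := (1 - 2 * δ)⁻¹ with hθ
  have hθ0 : 0 < θ := inv_pos.2 hd2
  have hθ1 : 1 ≤ θ := (one_le_inv₀ hd2).2 (by linarith)
  have hθδ : 1 + δ ≤ θ := by
    rw [hθ, ← one_div, le_div_iff₀ hd2]; nlinarith
  have hθδ' : (1 - δ)⁻¹ ≤ θ := inv_anti₀ hd2 (by linarith)
  have hin : ∀ z ∈ A, |inner ℝ w z - 1| ≤ δ := by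
    intro z hz
    have e : inner ℝ w z - 1 = inner ℝ (w - gradient g z) z := by
      rw [inner_sub_left, h.inner_gradient_self (hAr hz).2, (hAr hz).1]
    rw [e]
    refine (abs_real_inner_le_norm _ _).trans (le_trans ?_ (hw z hz))
    rw [norm_sub_rev]
    exact mul_le_mul_of_nonneg_left (hM z (hAr hz).1) (norm_nonneg _)
  have hin0 : ∀ z ∈ A, 0 < inner ℝ w z := fun z hz => by
    have := (abs_le.1 (hin z hz)).1; linarith
  have hw0 : w ≠ 0 := by
    rintro rfl
    have := hin0 z₀ hz₀
    rw [inner_zero_left] at this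
    exact lt_irrefl _ this
  have hwn : 0 < ‖w‖ := norm_pos_iff.2 hw0
  have hgrad : ∀ z ∈ A, 0 < ‖gradient g z‖ ∧ ‖gradient g z‖⁻¹ ≤ θ * ‖w‖⁻¹ ∧
      ‖w‖⁻¹ ≤ θ * ‖gradient g z‖⁻¹ := by
    intro z hz
    set G := ‖gradient g z‖ with hG
    have h1 : 1 ≤ G * M := by
      have h2 := real_inner_le_norm (gradient g z) z
      rw [h.inner_gradient_self (hAr hz).2, (hAr hz).1] at h2
      exact h2.trans (mul_le_mul_of_nonneg_left (hM z (hAr hz).1) (norm_nonneg _))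
    have hG0 : 0 < G := pos_of_mul_pos_left (lt_of_lt_of_le one_pos h1) hM0.le
    have h3 : |G - ‖w‖| ≤ δ * G := by
      have h4 := abs_norm_sub_norm_le (gradient g z) w
      have h5 := hw z hz
      have h6 : |G - ‖w‖| * M ≤ δ := (mul_le_mul_of_nonneg_right h4 hM0.le).trans h5
      have h7 : |G - ‖w‖| * M * G ≤ δ * G := mul_le_mul_of_nonneg_right h6 hG0.le
      nlinarith [abs_nonneg (G - ‖w‖)]
    obtain ⟨h4, h5⟩ := abs_le.1 h3
    refine ⟨hG0, ?_, ?_⟩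
    · rw [← div_eq_mul_inv, le_div_iff₀ hwn, ← div_eq_inv_mul, div_le_iff₀ hG0]
      nlinarith
    · have hθG : (1 - δ) * θ ≥ 1 := by
        have := mul_le_mul_of_nonneg_left hθδ' (by linarith : 0 ≤ 1 - δ)
        rwa [mul_inv_cancel₀ (by linarith)] at this
      rw [← div_eq_mul_inv, le_div_iff₀ hG0, ← div_eq_inv_mul, div_le_iff₀ hwn]
      nlinarith
  set H : Measure (Vec n) := Measure.euclideanHausdorffMeasure (n - 1) with hH
  set Θ := ENNReal.ofReal θ with hΘ
  have hΘ1 : 1 ≤ Θ := by rwa [hΘ, ENNReal.one_le_ofReal]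
  set W := ENNReal.ofReal ‖w‖⁻¹ with hW
  set c := coneConst n with hc
  set V := volume (openCone g A ∩ {x | g x ≤ 1}) with hV
  set I := ∫⁻ z in A, ENNReal.ofReal ‖gradient g z‖⁻¹ ∂H with hI
  have hgm : Measurable fun z => ENNReal.ofReal ‖gradient g z‖⁻¹ :=
    (measurable_gradient g).norm.inv.ennreal_ofReal
  have I1 : I ≤ Θ * (W * H A) := by
    rw [← mul_assoc, ← ENNReal.ofReal_mul hθ0.le, ← setLIntegral_const]
    exact setLIntegral_mono measurable_const fun z hz => ENNReal.ofReal_le_ofReal (hgrad z hz).2.1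
  have I2 : W * H A ≤ Θ * I := by
    rw [hI, ← lintegral_const_mul _ hgm, ← setLIntegral_const]
    refine setLIntegral_mono (hgm.const_mul _) fun z hz => ?_
    rw [← ENNReal.ofReal_mul hθ0.le]
    exact ENNReal.ofReal_le_ofReal (hgrad z hz).2.2
  -- `B` is the flat section of the cone; `P : A → B` and `radialProj g : B → A` are mutually
  -- inverse, and both are `θ²`-Lipschitz.
  set B := openCone g A ∩ {x | inner ℝ w x = 1} with hB
  set P : Vec n → Vec n := fun z => (inner ℝ w z : ℝ)⁻¹ • z with hP
  have hBA : ∀ x ∈ B, radialProj g x ∈ A ∧ P (radialProj g x) = x := by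
    rintro x ⟨⟨hx0, hx⟩, hx1⟩
    refine ⟨hx, ?_⟩
    have hx1 : inner ℝ w x = 1 := hx1
    simp only [hP, radialProj, inner_smul_right, hx1, mul_one, inv_inv]
    rw [smul_smul, mul_inv_cancel₀ (h.pos x hx0).ne', one_smul]
  have hAB : ∀ z ∈ A, P z ∈ B ∧ radialProj g (P z) = z := by
    intro z hz
    have ha := inv_pos.2 (hin0 z hz)
    have e : radialProj g (P z) = z := by
      simp only [hP]
      rw [h.radialProj_smul ha, radialProj_of_eq_one (hAr hz).1]
    refine ⟨⟨⟨smul_ne_zero ha.ne' (h.ne_zero_of_eq_one (hAr hz).1), by rwa [e]⟩, ?_⟩, e⟩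
    simp only [hP, Set.mem_ofPred_eq, inner_smul_right]
    exact inv_mul_cancel₀ (hin0 z hz).ne'
  have hL : ∀ z ∈ A, ∀ y ∈ A, ‖P z - P y‖ ≤ θ ^ 2 * ‖z - y‖ ∧ ‖z - y‖ ≤ θ ^ 2 * ‖P z - P y‖ :=
    fun z hz y hy => norm_sub_le_of_flat hδ.le hδ2 (hM y (hAr hy).1) (hin z hz) (hin y hy)
      (hflat z hz y hy)
  have hΘc : ((Real.toNNReal (θ ^ 2) : NNReal) : ℝ≥0∞) = Θ ^ 2 := by
    rw [← ENNReal.ofReal, ENNReal.ofReal_pow hθ0.le]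
  have I3 : H B ≤ (Θ ^ 2) ^ (n - 1) * H A := by
    have hl : LipschitzOnWith (Real.toNNReal (θ ^ 2)) P A := by
      refine LipschitzOnWith.of_dist_le_mul fun z hz y hy => ?_
      rw [dist_eq_norm, dist_eq_norm, Real.coe_toNNReal _ (by positivity)]
      exact (hL z hz y hy).1
    have := euclideanHausdorffMeasure_image_le hl (n - 1)
    rw [hΘc] at this
    exact (measure_mono (show B ⊆ P '' A from
      fun x hx => ⟨_, (hBA x hx).1, (hBA x hx).2⟩)).trans this
  have I4 : H A ≤ (Θ ^ 2) ^ (n - 1) * H B := by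
    have hl : LipschitzOnWith (Real.toNNReal (θ ^ 2)) (radialProj g) B := by
      refine LipschitzOnWith.of_dist_le_mul fun x hx y hy => ?_
      rw [dist_eq_norm, dist_eq_norm, Real.coe_toNNReal _ (by positivity)]
      have := (hL _ (hBA x hx).1 _ (hBA y hy).1).2
      rwa [(hBA x hx).2, (hBA y hy).2] at this
    have := euclideanHausdorffMeasure_image_le hl (n - 1)
    rw [hΘc] at this
    exact (measure_mono (show A ⊆ radialProj g '' B from
      fun z hz => ⟨_, (hAB z hz).1, (hAB z hz).2⟩)).trans this
  set F := volume (openCone g A ∩ {x | 0 < inner ℝ w x ∧ inner ℝ w x ≤ 1}) with hF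
  have hFe : F = W * (c * H B) :=
    volume_cone_inter_slab (h.measurableSet_openCone hA) (fun t x ht => h.smul_mem_openCone ht x) hw0
  have hdir : ∀ x ∈ openCone g A, 0 < g x ∧
      inner ℝ w x = g x * inner ℝ w (radialProj g x) ∧ radialProj g x ∈ A := by
    rintro x ⟨hx0, hx⟩
    refine ⟨h.pos x hx0, ?_, hx⟩
    conv_lhs => rw [← h.smul_radialProj hx0]
    rw [inner_smul_right]
  have I5 : F ≤ Θ ^ n * V := by
    rw [hΘ, hV, ← h.volume_openCone_inter_le A hθ0]
    refine measure_mono ?_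
    rintro x ⟨hx, -, hx1⟩
    refine ⟨hx, ?_⟩
    obtain ⟨h1, h2, h3⟩ := hdir x hx
    have hb := (abs_le.1 (hin _ h3)).1
    rw [h2] at hx1
    have : g x ≤ (1 - δ)⁻¹ := by
      rw [← one_div, le_div_iff₀ (by linarith)]
      nlinarith
    exact this.trans hθδ'
  have I6 : V ≤ Θ ^ n * F := by
    have h1 : ENNReal.ofReal θ⁻¹ ^ n * V ≤ F := by
      rw [hV, ← h.volume_openCone_inter_le A (inv_pos.2 hθ0)]
      refine measure_mono ?_
      rintro x ⟨hx, hx1⟩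
      obtain ⟨h1, h2, h3⟩ := hdir x hx
      have hb := (abs_le.1 (hin _ h3)).2
      have hx1 : g x ≤ θ⁻¹ := hx1
      refine ⟨hx, ?_, ?_⟩
      · rw [h2]; exact mul_pos h1 (hin0 _ h3)
      · rw [h2]
        calc g x * inner ℝ w (radialProj g x) ≤ θ⁻¹ * θ :=
              mul_le_mul hx1 (by linarith) (hin0 _ h3).le (by positivity)
          _ = 1 := inv_mul_cancel₀ hθ0.ne'
    calc V = Θ ^ n * (ENNReal.ofReal θ⁻¹ ^ n * V) := by
          rw [← mul_assoc, ← mul_pow, ← ENNReal.ofReal_mul hθ0.le, mul_inv_cancel₀ hθ0.ne']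
          simp
      _ ≤ Θ ^ n * F := by gcongr
  -- The exponent `3n + 1` leaves slack, so that the bound also holds for `n = 0`, where `n - 1` is
  -- truncated.
  have hpow : Θ * (Θ ^ 2) ^ (n - 1) * Θ ^ n ≤ ENNReal.ofReal (θ ^ (3 * n + 1)) := by
    rw [ENNReal.ofReal_pow hθ0.le, ← pow_mul, ← pow_succ', ← pow_add]
    exact pow_le_pow_right₀ hΘ1 (by omega)
  constructor
  · calc c * I ≤ c * (Θ * (W * H A)) := by gcongr
      _ ≤ c * (Θ * (W * ((Θ ^ 2) ^ (n - 1) * H B))) := by gcongr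
      _ = Θ * (Θ ^ 2) ^ (n - 1) * F := by rw [hFe]; ring
      _ ≤ Θ * (Θ ^ 2) ^ (n - 1) * (Θ ^ n * V) := by gcongr
      _ = Θ * (Θ ^ 2) ^ (n - 1) * Θ ^ n * V := by ring
      _ ≤ _ := by gcongr
  · calc V ≤ Θ ^ n * F := I6
      _ = Θ ^ n * (W * (c * H B)) := by rw [hFe]
      _ ≤ Θ ^ n * (W * (c * ((Θ ^ 2) ^ (n - 1) * H A))) := by gcongr
      _ = Θ ^ n * (Θ ^ 2) ^ (n - 1) * c * (W * H A) := by ring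
      _ ≤ Θ ^ n * (Θ ^ 2) ^ (n - 1) * c * (Θ * I) := by gcongr
      _ = Θ * (Θ ^ 2) ^ (n - 1) * Θ ^ n * (c * I) := by ring
      _ ≤ _ := by gcongr

end IsLipGauge

/-! ### The cone measure formula -/

namespace IsLipGauge

variable {n : ℕ} {K : Set (Vec n)} {g : Vec n → ℝ}

theorem exists_mul_norm_le (h : IsLipGauge K g) : ∃ m : ℝ, 0 < m ∧ ∀ x, m * ‖x‖ ≤ g x := by
  have key : ∃ m : ℝ, 0 < m ∧ ∀ u ∈ Metric.sphere (0 : Vec n) 1, m ≤ g u := by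
    rcases (Metric.sphere (0 : Vec n) 1).eq_empty_or_nonempty with he | hne
    · exact ⟨1, one_pos, by simp [he]⟩
    · obtain ⟨u₀, hu₀, hmin⟩ :=
        (isCompact_sphere (0 : Vec n) 1).exists_isMinOn hne h.continuous.continuousOn
      refine ⟨g u₀, h.pos u₀ ?_, fun u hu => hmin hu⟩
      rintro rfl
      simp at hu₀
  obtain ⟨m, hm, hu⟩ := key
  refine ⟨m, hm, fun x => ?_⟩
  rcases eq_or_ne x 0 with rfl | hx
  · simp [h.map_zero]
  have hx' : 0 < ‖x‖ := norm_pos_iff.2 hx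
  have h1 := hu (‖x‖⁻¹ • x) (by simp [norm_smul, inv_mul_cancel₀ hx'.ne'])
  rw [h.map_smul _ _ (inv_nonneg.2 hx'.le), ← div_eq_inv_mul, le_div_iff₀ hx'] at h1
  exact h1

theorem exists_norm_le (h : IsLipGauge K g) : ∃ M : ℝ, 0 < M ∧ ∀ z, g z ≤ 1 → ‖z‖ ≤ M := by
  obtain ⟨m, hm, hle⟩ := h.exists_mul_norm_le
  refine ⟨m⁻¹, inv_pos.2 hm, fun z hz => ?_⟩
  rw [← one_div, le_div_iff₀ hm, mul_comm]
  exact (hle z).trans hz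

/-- Sort boundary points by a ball of radius `ε` containing the gradient, countably many balls being
enough by separability, then subdivide so that `g` is `ε`-close to linear on each piece. The linear
maps are gradients at points of the same class, hence the bound `2ε = δ/M`. -/
theorem exists_flat_cover (h : IsLipGauge K g) {M δ : ℝ} (hM : 0 < M) (hδ : 0 < δ) :
    ∃ t : ℕ → Set (Vec n), (∀ i, MeasurableSet (t i)) ∧ regBoundary K ⊆ ⋃ i, t i ∧
      ∀ i, ∃ w : Vec n, ∀ z ∈ regBoundary K ∩ t i, ‖gradient g z - w‖ * M ≤ δ ∧
        ∀ y ∈ regBoundary K ∩ t i, |inner ℝ w (z - y)| * M ≤ δ * ‖z - y‖ := by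
  set ε : ℝ := δ / (2 * M) with hε
  have hε0 : 0 < ε := by positivity
  have hεM : 2 * ε * M = δ := by rw [hε]; field_simp
  set q : ℕ → Vec n := TopologicalSpace.denseSeq (Vec n) with hq
  set S : ℕ → Set (Vec n) := fun j => regBoundary K ∩ {z | ‖gradient g z - q j‖ < ε} with hS
  have hSm : ∀ j, MeasurableSet (S j) := fun j => h.measurableSet_regBoundary.inter
    (measurableSet_lt ((measurable_gradient g).sub_const _).norm measurable_const)
  have hpart : ∀ j, ∃ t : ℕ → Set (Vec n), (∀ i, MeasurableSet (t i)) ∧ (S j ⊆ ⋃ i, t i) ∧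
      ∀ i, ∃ w : Vec n, ∀ z ∈ S j ∩ t i, ‖gradient g z - w‖ * M ≤ δ ∧
        ∀ y ∈ S j ∩ t i, |inner ℝ w (z - y)| * M ≤ δ * ‖z - y‖ := by
    intro j
    obtain ⟨t, A, -, htm, hst, happ, hA⟩ :=
      exists_partition_approximatesLinearOn_of_hasFDerivWithinAt g (S j) (fderiv ℝ g)
        (fun x hx => by
          have := hx.1
          rw [h.regBoundary_eq] at this
          exact this.2.hasFDerivAt.hasFDerivWithinAt)
        (fun _ => ⟨ε, hε0.le⟩) (fun _ => by
          intro h0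
          exact hε0.ne' (congrArg NNReal.toReal h0))
    refine ⟨t, htm, hst, fun i => ⟨(InnerProductSpace.toDual ℝ (Vec n)).symm (A i), ?_⟩⟩
    intro z hz
    obtain ⟨y₀, hy₀, hAy⟩ := hA ⟨z, hz.1⟩ i
    have hwe : (InnerProductSpace.toDual ℝ (Vec n)).symm (A i) = gradient g y₀ := by
      rw [hAy, gradient]
    constructor
    · rw [hwe, ← hεM]
      have h1 : ‖gradient g z - q j‖ < ε := hz.1.2
      have h2 : ‖gradient g y₀ - q j‖ < ε := hy₀.2
      have h3 : ‖gradient g z - gradient g y₀‖ ≤ 2 * ε := by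
        have := norm_sub_le (gradient g z - q j) (gradient g y₀ - q j)
        rw [sub_sub_sub_cancel_right] at this
        linarith
      gcongr
    · intro y hy
      have hz1 : g z = 1 := by have := hz.1.1; rw [h.regBoundary_eq] at this; exact this.1
      have hy1 : g y = 1 := by have := hy.1.1; rw [h.regBoundary_eq] at this; exact this.1
      have h1 := happ i z hz y hy
      -- Because `g = 1` at both points, approximate linearity bounds the linear part alone.
      rw [hz1, hy1, sub_self, zero_sub, norm_neg, Real.norm_eq_abs] at h1
      have h1 : |A i (z - y)| ≤ ε * ‖z - y‖ := h1
      rw [InnerProductSpace.toDual_symm_apply, ← hεM]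
      have h2 := mul_le_mul_of_nonneg_right h1 hM.le
      have h3 : 0 ≤ ε * ‖z - y‖ * M := by positivity
      nlinarith
  choose t htm hst hw using hpart
  refine ⟨fun k => S k.unpair.1 ∩ t k.unpair.1 k.unpair.2, fun k => (hSm _).inter (htm _ _),
    ?_, fun k => ?_⟩
  · intro z hz
    obtain ⟨j, hj⟩ := (TopologicalSpace.denseRange_denseSeq (Vec n)).exists_dist_lt
      (gradient g z) hε0
    rw [dist_eq_norm] at hj
    have hzS : z ∈ S j := ⟨hz, hj⟩
    obtain ⟨i, hi⟩ := Set.mem_iUnion.1 (hst j hzS)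
    exact Set.mem_iUnion.2 ⟨Nat.pair j i, by simpa using ⟨hzS, hi⟩⟩
  · obtain ⟨w, hw⟩ := hw k.unpair.1 k.unpair.2
    exact ⟨w, fun z hz => ⟨(hw z hz.2).1, fun y hy => (hw z hz.2).2 y hy.2⟩⟩

/-- Integration over the regular part of the boundary in polar form: up to a constant factor, the
measure `(z · ν(z)) dℋ^{n-1}(z)` is the cone measure. -/
theorem lintegral_regBoundary (h : IsLipGauge K g) {F : Vec n → ℝ≥0∞} (hF : Measurable F) :
    coneConst n * ∫⁻ z in regBoundary K, ENNReal.ofReal ‖gradient g z‖⁻¹ * F z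
        ∂(Measure.euclideanHausdorffMeasure (n - 1) : Measure (Vec n)) =
      ∫⁻ x in openCone g (regBoundary K) ∩ {x | g x ≤ 1}, F (radialProj g x) := by
  set H : Measure (Vec n) := Measure.euclideanHausdorffMeasure (n - 1) with hH
  set φ : Vec n → ℝ≥0∞ := fun z => ENNReal.ofReal ‖gradient g z‖⁻¹ with hφ
  have hφm : Measurable φ := (measurable_gradient g).norm.inv.ennreal_ofReal
  set R := regBoundary K with hR
  have hRm : MeasurableSet R := h.measurableSet_regBoundary
  -- The formula is an equality of two measures: the weighted surface measure `μ₁`, and the image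
  -- `μ₂` of Lebesgue measure under radial projection.
  set μ₁ : Measure (Vec n) := coneConst n • (H.restrict R).withDensity φ with hμ₁
  set μ₂ : Measure (Vec n) :=
    (volume.restrict (openCone g R ∩ {x | g x ≤ 1})).map (radialProj g) with hμ₂
  have e₁ : ∀ A, MeasurableSet A → μ₁ A = coneConst n * ∫⁻ z in A ∩ R, φ z ∂H := by
    intro A hA
    rw [hμ₁, Measure.smul_apply, withDensity_apply _ hA, Measure.restrict_restrict hA, smul_eq_mul]
  have e₂ : ∀ A, MeasurableSet A → μ₂ A = volume (openCone g (A ∩ R) ∩ {x | g x ≤ 1}) := by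
    intro A hA
    rw [hμ₂, Measure.map_apply h.measurable_radialProj hA,
      Measure.restrict_apply (h.measurable_radialProj hA)]
    congr 1
    ext x
    simp only [openCone, Set.mem_inter_iff, Set.mem_preimage, Set.mem_ofPred_eq]
    tauto
  obtain ⟨M, hM, hMle⟩ := h.exists_norm_le
  have hcover : ∀ θ : ℝ, 1 < θ → ∃ t : ℕ → Set (Vec n), (∀ i, MeasurableSet (t i)) ∧
      R ⊆ ⋃ i, t i ∧ ∀ i, ∀ A ⊆ R ∩ t i, MeasurableSet A →
        μ₁ A ≤ ENNReal.ofReal (θ ^ (3 * n + 1)) * μ₂ A ∧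
        μ₂ A ≤ ENNReal.ofReal (θ ^ (3 * n + 1)) * μ₁ A := by
    intro θ hθ
    have hθ1 : θ⁻¹ < 1 := inv_lt_one_of_one_lt₀ hθ
    have hθ0 : 0 < θ⁻¹ := inv_pos.2 (by linarith)
    -- The choice `δ = (1 - θ⁻¹)/2` makes `(1 - 2δ)⁻¹ = θ`.
    have hδ0 : 0 < (1 - θ⁻¹) / 2 := by linarith
    obtain ⟨t, htm, hst, ht⟩ := h.exists_flat_cover hM hδ0
    refine ⟨t, htm, hst, fun i A hA hAm => ?_⟩
    obtain ⟨w, hw⟩ := ht i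
    have hAR : A ∩ R = A := Set.inter_eq_left.2 fun z hz => (hA hz).1
    have key := h.cone_comparison hM (fun z hz => hMle z hz.le) hδ0 (by linarith) hAm
      (fun z hz => (hA hz).1) (fun z hz => (hw z (hA hz)).1)
      (fun z hz y hy => (hw z (hA hz)).2 y (hA hy))
    rw [show (1 - 2 * ((1 - θ⁻¹) / 2))⁻¹ = θ by rw [mul_div_cancel₀ _ two_ne_zero]; simp] at key
    rw [e₁ A hAm, e₂ A hAm, hAR]
    exact key
  have heq : μ₁ = μ₂ := by
    have hsub : ∀ A, MeasurableSet A → μ₁ (A ∩ R) = μ₂ (A ∩ R) := by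
      intro A hA
      apply le_antisymm
      · refine measure_le_of_forall_countable_cover (N := 3 * n + 1) (fun θ hθ => ?_)
          (hA.inter hRm) Set.inter_subset_right
        obtain ⟨t, htm, hst, ht⟩ := hcover θ hθ
        exact ⟨t, htm, hst, fun i A hA hAm => (ht i A hA hAm).1⟩
      · refine measure_le_of_forall_countable_cover (N := 3 * n + 1) (fun θ hθ => ?_)
          (hA.inter hRm) Set.inter_subset_right
        obtain ⟨t, htm, hst, ht⟩ := hcover θ hθ
        exact ⟨t, htm, hst, fun i A hA hAm => (ht i A hA hAm).2⟩
    ext A hA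
    have h1 := hsub A hA
    rw [e₁ _ (hA.inter hRm), e₂ _ (hA.inter hRm), Set.inter_assoc, Set.inter_self, ← e₁ A hA,
      ← e₂ A hA] at h1
    exact h1
  calc _ = ∫⁻ z, F z ∂μ₁ := by
        rw [hμ₁, lintegral_smul_measure, smul_eq_mul,
          lintegral_withDensity_eq_lintegral_mul _ hφm hF]
        rfl
    _ = ∫⁻ z, F z ∂μ₂ := by rw [heq]
    _ = _ := by rw [hμ₂, lintegral_map hF h.measurable_radialProj]

end IsLipGauge

/-! ### Monotonicity from an almost everywhere sign of the derivative -/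

/-- By Fubini, for almost every `y` the condition holds at almost every point of the line `y + t v`.
There `g` is absolutely continuous, so integrating its derivative gives the inequality at `y`;
continuity extends it from a dense set to every point. -/
theorem le_of_ae_fderiv_nonpos {n : ℕ} {C : NNReal} {g : Vec n → ℝ} (hg : LipschitzWith C g)
    {v : Vec n} (h : ∀ᵐ y, fderiv ℝ g y v ≤ 0) (x : Vec n) : g (x + v) ≤ g x := by
  set E : Set (Vec n) := {y | DifferentiableAt ℝ g y ∧ fderiv ℝ g y v ≤ 0} with hE
  have hEm : MeasurableSet E := (measurableSet_of_differentiableAt ℝ g).inter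
    (measurableSet_le (measurable_fderiv_apply_const ℝ g v) measurable_const)
  have hEae : ∀ᵐ y, y ∈ E := by
    filter_upwards [h, hg.ae_differentiableAt] with y h1 h2 using ⟨h2, h1⟩
  set L : ℝ →ₗ[ℝ] Vec n := LinearMap.toSpanSingleton ℝ (Vec n) v with hL
  have hae := (ae_ae_add_linearMap_mem_iff L (volume : Measure ℝ) volume hEm).2 hEae
  have hae2 : ∀ᵐ y : Vec n, g (y + v) ≤ g y := by
    filter_upwards [hae] with y hy
    set f : ℝ → ℝ := fun t => g (y + t • v) with hf
    have hline : LipschitzWith ‖v‖₊ fun t : ℝ => y + t • v := by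
      refine LipschitzWith.of_dist_le_mul fun s t => ?_
      rw [dist_add_left, dist_eq_norm, ← sub_smul, norm_smul, Real.dist_eq, mul_comm, coe_nnnorm,
        Real.norm_eq_abs]
    have hac : AbsolutelyContinuousOnInterval f 0 1 :=
      ((hg.comp hline).lipschitzOnWith).absolutelyContinuousOnInterval
    have hint := hac.integral_deriv_eq_sub
    have hneg : ∫ t in (0 : ℝ)..1, deriv f t ≤ 0 := by
      rw [intervalIntegral.integral_of_le zero_le_one]
      refine integral_nonpos_of_ae (ae_restrict_of_ae ?_)
      filter_upwards [hy] with t ht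
      have ht : y + t • v ∈ E := ht
      have h1 : HasDerivAt (fun t : ℝ => y + t • v) ((1 : ℝ) • v) t :=
        ((hasDerivAt_id t).smul_const v).const_add y
      have h2 : HasDerivAt f (fderiv ℝ g (y + t • v) ((1 : ℝ) • v)) t :=
        ht.1.hasFDerivAt.comp_hasDerivAt t h1
      rw [h2.deriv, one_smul]
      exact ht.2
    rw [hint] at hneg
    simp only [hf, one_smul, zero_smul, add_zero] at hneg
    linarith
  have hcl : IsClosed {y : Vec n | g (y + v) ≤ g y} :=
    isClosed_le (hg.continuous.comp (continuous_add_const v)) hg.continuous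
  have hd : Dense {y : Vec n | g (y + v) ≤ g y} := Measure.dense_of_ae hae2
  exact hcl.closure_subset (hd x)

/-! ### Support functions and the product `vᵀx` -/

section SupportFn

variable {m : ℕ} {Q : Set (Vec m)}

theorem bddAbove_inner_image (hQ : IsCompact Q) (w : Vec m) :
    BddAbove ((fun q => (inner ℝ w q : ℝ)) '' Q) :=
  (hQ.image (by fun_prop)).bddAbove

theorem inner_le_supportFn (hQ : IsCompact Q) (w : Vec m) {q : Vec m} (hq : q ∈ Q) :
    inner ℝ w q ≤ supportFn Q w :=
  le_csSup (bddAbove_inner_image hQ w) ⟨q, hq, rfl⟩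

theorem supportFn_le (hQ : Q.Nonempty) {w : Vec m} {b : ℝ} (h : ∀ q ∈ Q, inner ℝ w q ≤ b) :
    supportFn Q w ≤ b :=
  csSup_le (hQ.image _) (by rintro _ ⟨q, hq, rfl⟩; exact h q hq)

theorem supportFn_nonneg (hQ : IsCompact Q) (hQ0 : (0 : Vec m) ∈ Q) (w : Vec m) :
    0 ≤ supportFn Q w := by
  simpa using inner_le_supportFn hQ w hQ0

theorem supportFn_add_le (hQ : IsCompact Q) (hQn : Q.Nonempty) (w w' : Vec m) :
    supportFn Q (w + w') ≤ supportFn Q w + supportFn Q w' :=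
  supportFn_le hQn fun q hq => by
    rw [inner_add_left]
    exact add_le_add (inner_le_supportFn hQ w hq) (inner_le_supportFn hQ w' hq)

theorem supportFn_smul {c : ℝ} (hc : 0 ≤ c) (w : Vec m) :
    supportFn Q (c • w) = c * supportFn Q w := by
  rw [supportFn, supportFn, ← smul_eq_mul, ← Real.sSup_smul_of_nonneg hc, ← Set.image_smul,
    Set.image_image]
  simp only [inner_smul_left, conj_trivial, smul_eq_mul]

theorem supportFn_smul_set {c : ℝ} (hc : 0 ≤ c) (w : Vec m) :
    supportFn (c • Q) w = c * supportFn Q w := by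
  rw [supportFn, supportFn, ← smul_eq_mul, ← Real.sSup_smul_of_nonneg hc, ← Set.image_smul,
    ← Set.image_smul, Set.image_image, Set.image_image]
  simp only [inner_smul_right, smul_eq_mul]

theorem exists_supportFn_le (hQ : IsCompact Q) (hQn : Q.Nonempty) :
    ∃ R : ℝ, 0 ≤ R ∧ ∀ w, supportFn Q w ≤ R * ‖w‖ := by
  obtain ⟨R, hR0, hR⟩ := hQ.isBounded.exists_pos_norm_le
  refine ⟨R, hR0.le, fun w => supportFn_le hQn fun q hq => ?_⟩
  refine (real_inner_le_norm _ _).trans ?_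
  rw [mul_comm]
  exact mul_le_mul_of_nonneg_right (hR q hq) (norm_nonneg _)

theorem continuous_supportFn (hQ : IsCompact Q) (hQn : Q.Nonempty) :
    Continuous (supportFn Q) := by
  obtain ⟨R, hR0, hR⟩ := exists_supportFn_le hQ hQn
  refine (LipschitzWith.of_le_add_mul ⟨R, hR0⟩ fun x y => ?_).continuous
  have h1 := supportFn_add_le hQ hQn y (x - y)
  rw [add_sub_cancel] at h1
  rw [dist_eq_norm]
  exact h1.trans (add_le_add_right (hR (x - y)) _)

end SupportFn

section RowMul

variable {n m : ℕ}

theorem rowMul_add_left (v w : Vec n) (x : Mat n m) :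
    rowMul (v + w) x = rowMul v x + rowMul w x := by
  simp [rowMul, Matrix.add_vecMul]

theorem rowMul_smul_left (c : ℝ) (v : Vec n) (x : Mat n m) :
    rowMul (c • v) x = c • rowMul v x := by
  simp [rowMul, Matrix.smul_vecMul]

theorem rowMul_add_right (v : Vec n) (x y : Mat n m) :
    rowMul v (x + y) = rowMul v x + rowMul v y := by
  simp [rowMul, Matrix.vecMul_add]

theorem rowMul_smul_right (c : ℝ) (v : Vec n) (x : Mat n m) :
    rowMul v (c • x) = c • rowMul v x := by
  simp [rowMul, Matrix.vecMul_smul]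

/-- `v ↦ vᵀ x` as a continuous linear map. -/
def rowMulCLM (x : Mat n m) : Vec n →L[ℝ] Vec m :=
  LinearMap.toContinuousLinearMap
    { toFun := fun v => rowMul v x
      map_add' := fun v w => rowMul_add_left v w x
      map_smul' := fun c v => rowMul_smul_left c v x }

theorem rowMulCLM_apply (x : Mat n m) (v : Vec n) : rowMulCLM x v = rowMul v x := rfl

theorem inner_rowMul (v : Vec n) (x : Mat n m) (q : Vec m) :
    inner ℝ (rowMul v x) q = inner ℝ v (WithLp.toLp 2 (x.mulVec q.ofLp) : Vec n) := by
  simp only [rowMul, EuclideanSpace.inner_eq_star_dotProduct, star_trivial]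
  rw [dotProduct_comm, ← Matrix.dotProduct_mulVec, dotProduct_comm]

/-- If `x` vanished on `Q`, it would vanish on differences of points near an interior point, hence
on every basis vector. -/
theorem exists_mulVec_ne_zero {Q : Set (Vec m)} (hQ : (interior Q).Nonempty) {x : Mat n m}
    (hx : x ≠ 0) : ∃ q ∈ Q, (WithLp.toLp 2 (x.mulVec q.ofLp) : Vec n) ≠ 0 := by
  by_contra! hcon
  obtain ⟨q₀, hq₀⟩ := hQ
  have hcon' : ∀ q ∈ Q, x.mulVec q.ofLp = 0 := fun q hq => by
    simpa using hcon q hq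
  apply hx
  refine Matrix.ext_of_mulVec_single fun j => ?_
  rw [Matrix.zero_mulVec]
  have hc : Tendsto (fun t : ℝ => q₀ + t • (WithLp.toLp 2 (Pi.single j (1 : ℝ)) : Vec m))
      (𝓝[>] 0) (𝓝 q₀) := by
    have : Continuous fun t : ℝ => q₀ + t • (WithLp.toLp 2 (Pi.single j (1 : ℝ)) : Vec m) := by
      fun_prop
    have := this.tendsto 0
    rw [zero_smul, add_zero] at this
    exact this.mono_left nhdsWithin_le_nhds
  obtain ⟨t, ht, ht0⟩ :=
    ((hc.eventually (mem_interior_iff_mem_nhds.1 hq₀)).and self_mem_nhdsWithin).exists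
  have ht0 : 0 < t := ht0
  have h1 := hcon' _ ht
  rw [WithLp.ofLp_add, WithLp.ofLp_smul, Matrix.mulVec_add, Matrix.mulVec_smul,
    hcon' q₀ (interior_subset hq₀), zero_add, smul_eq_zero] at h1
  exact h1.resolve_left ht0.ne'

end RowMul

/-! ### The volume formula, finiteness, positivity and sublinearity -/

namespace IsLipGauge

variable {n m : ℕ} {K : Set (Vec n)} {g : Vec n → ℝ}

/-- All later properties are read off from this formula, whose integrand involves only `∇g` and
whose domain is a bounded set of full dimension. -/
theorem projFn_eq (h : IsLipGauge K g) (hn : 1 ≤ n) {p : ℝ} (hp : 1 ≤ p) {Q : Set (Vec m)}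
    (hQ : IsCompact Q) (hQ0 : (0 : Vec m) ∈ Q) (x : Mat n m) :
    projFn p Q K x = ((coneConst n)⁻¹ * ∫⁻ y in {y | g y ≤ 1},
      ENNReal.ofReal (supportFn Q (rowMul (gradient g y) x)) ^ p) ^ (1 / p) := by
  have hp0 : 0 < p := by linarith
  have hRm := h.measurableSet_regBoundary
  set F : Vec n → ℝ≥0∞ := fun y => ENNReal.ofReal (supportFn Q (rowMul (gradient g y) x)) ^ p
    with hF
  have hFm : Measurable F :=
    (((continuous_supportFn hQ ⟨0, hQ0⟩).measurable.comp
      ((rowMulCLM x).continuous.measurable.comp (measurable_gradient g))).ennreal_ofReal).pow_const p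
  -- The gradient is `0` by default where `g` is not differentiable, so the cone over the
  -- non-regular boundary contributes nothing.
  have hF0 : ∀ y, gradient g y = 0 → F y = 0 := by
    intro y hy
    have h1 : rowMul (0 : Vec n) x = 0 := (rowMulCLM x).map_zero
    have h2 : supportFn Q (0 : Vec m) = 0 := by
      simpa using supportFn_smul (Q := Q) le_rfl (0 : Vec m)
    simp [hF, hy, h1, h2, hp0]
  have hFr : ∀ y, y ≠ 0 → F (radialProj g y) = F y := by
    intro y hy
    simp only [hF, radialProj, h.gradient_smul (inv_pos.2 (h.pos y hy))]
  have key := h.lintegral_regBoundary hFm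
  have e₁ : ∫⁻ y in openCone g (regBoundary K) ∩ {y | g y ≤ 1}, F (radialProj g y) =
      ∫⁻ y in {y | g y ≤ 1}, F y := by
    have hm1 : MeasurableSet {y : Vec n | g y ≤ 1} :=
      (isClosed_le h.continuous continuous_const).measurableSet
    -- The origin is a null set only in positive dimension.
    have : Nonempty (Fin n) := ⟨⟨0, hn⟩⟩
    have hne : ∀ᵐ y : Vec n, y ≠ 0 := by simp [ae_iff]
    rw [← lintegral_indicator ((h.measurableSet_openCone hRm).inter hm1),
      ← lintegral_indicator hm1]
    refine lintegral_congr_ae ?_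
    filter_upwards [hne] with y hy
    by_cases hy1 : g y ≤ 1
    · rw [Set.indicator_of_mem (s := {y : Vec n | g y ≤ 1}) hy1]
      by_cases hyR : radialProj g y ∈ regBoundary K
      · have hmem : y ∈ openCone g (regBoundary K) ∩ {y : Vec n | g y ≤ 1} := ⟨⟨hy, hyR⟩, hy1⟩
        rw [Set.indicator_of_mem hmem, hFr y hy]
      · rw [Set.indicator_of_notMem fun hh => hyR hh.1.2]
        rw [h.regBoundary_eq] at hyR
        have hnd : ¬ DifferentiableAt ℝ g (radialProj g y) :=
          fun hd => hyR ⟨h.gauge_radialProj hy, hd⟩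
        rw [← hFr y hy, hF0 _ (gradient_eq_zero_of_not_differentiableAt hnd)]
    · rw [Set.indicator_of_notMem (s := {y : Vec n | g y ≤ 1}) hy1,
        Set.indicator_of_notMem fun hh => hy1 hh.2]
  rw [e₁] at key
  rw [← key, ← mul_assoc, ENNReal.inv_mul_cancel (coneConst_ne_zero n) (coneConst_ne_top n),
    one_mul, projFn]
  congr 1
  refine setLIntegral_congr_fun hRm fun z hz => ?_
  have hz' := hz
  rw [h.regBoundary_eq] at hz'
  have hin : inner ℝ z (gradient g z) = 1 := by
    rw [real_inner_comm, h.inner_gradient_self hz'.2, hz'.1]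
  have hG : 0 < ‖gradient g z‖ := by
    rw [norm_pos_iff]
    intro h0
    rw [h0, inner_zero_right] at hin
    exact zero_ne_one hin
  have hs := supportFn_nonneg hQ hQ0 (rowMul (gradient g z) x)
  simp only [hF]
  rw [h.gaussMap_eq hz, rowMul_smul_left, supportFn_smul (inv_nonneg.2 hG.le), inner_smul_right,
    hin, mul_one, ENNReal.ofReal_rpow_of_nonneg hs hp0.le, ← ENNReal.ofReal_mul (by positivity),
    Real.mul_rpow (by positivity) hs, mul_right_comm, ← Real.rpow_add (inv_pos.2 hG),
    add_sub_cancel, Real.rpow_one]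

theorem volume_sublevel_lt_top (h : IsLipGauge K g) : volume {y | g y ≤ 1} < ⊤ := by
  obtain ⟨M, -, hM⟩ := h.exists_norm_le
  refine (measure_mono fun y hy => ?_).trans_lt (measure_closedBall_lt_top (x := (0 : Vec n)) (r := M))
  exact mem_closedBall_zero_iff.2 (hM y hy)

theorem projFn_lt_top (h : IsLipGauge K g) (hn : 1 ≤ n) {p : ℝ} (hp : 1 ≤ p) {Q : Set (Vec m)}
    (hQ : IsCompact Q) (hQ0 : (0 : Vec m) ∈ Q) (x : Mat n m) : projFn p Q K x < ⊤ := by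
  have hp0 : 0 < p := by linarith
  rw [h.projFn_eq hn hp hQ hQ0]
  refine ENNReal.rpow_lt_top_of_nonneg (by positivity) (ENNReal.mul_ne_top ?_ ?_)
  · exact ENNReal.inv_ne_top.2 (coneConst_ne_zero n)
  obtain ⟨C, hC⟩ := h.lip
  obtain ⟨R, hR0, hR⟩ := exists_supportFn_le hQ ⟨0, hQ0⟩
  have hb : ∀ y, supportFn Q (rowMul (gradient g y) x) ≤ R * (‖rowMulCLM x‖ * C) := by
    intro y
    refine (hR _).trans ?_
    gcongr
    rw [← rowMulCLM_apply]
    refine ((rowMulCLM x).le_opNorm _).trans ?_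
    gcongr
    rw [gradient, LinearIsometryEquiv.norm_map]
    exact norm_fderiv_le_of_lipschitz ℝ hC
  refine ne_top_of_le_ne_top ?_ (lintegral_mono fun y =>
    ENNReal.rpow_le_rpow (ENNReal.ofReal_le_ofReal (hb y)) hp0.le)
  rw [setLIntegral_const]
  exact ENNReal.mul_ne_top (ENNReal.rpow_ne_top_of_nonneg hp0.le ENNReal.ofReal_ne_top)
    h.volume_sublevel_lt_top.ne

/-- The set where `∇g · v > 0` is conical away from the origin, so if it is null in `{g ≤ 1}` it is
null everywhere. Then `g` does not increase from `0` to `v`, against `g(v) > 0`. -/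
theorem not_ae_inner_gradient_nonpos (h : IsLipGauge K g) {v : Vec n} (hv : v ≠ 0)
    (hae : ∀ᵐ y ∂volume.restrict {y | g y ≤ 1}, inner ℝ (gradient g y) v ≤ 0) : False := by
  have hm1 : MeasurableSet {y : Vec n | g y ≤ 1} :=
    (isClosed_le h.continuous continuous_const).measurableSet
  rw [ae_restrict_iff' hm1] at hae
  set A : Set (Vec n) := {y | 0 < inner ℝ (gradient g y) v} with hA
  have hcone : ∀ y, y ≠ 0 → (y ∈ openCone g A ↔ 0 < inner ℝ (gradient g y) v) := by
    intro y hy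
    simp only [openCone, hA, Set.mem_ofPred_eq, radialProj,
      h.gradient_smul (inv_pos.2 (h.pos y hy)), hy, ne_eq, not_false_eq_true, true_and]
  have h1 : volume (openCone g A ∩ {y | g y ≤ 1}) = 0 := by
    refine measure_mono_null ?_ hae
    rintro y ⟨hy, hy1⟩ hcon
    exact absurd (hcon hy1) (not_le.2 ((hcone y hy.1).1 hy))
  have h2 : volume (openCone g A) = 0 := by
    have e : openCone g A ⊆ ⋃ k : ℕ, openCone g A ∩ {y | g y ≤ (k : ℝ) + 1} := by
      intro y hy
      obtain ⟨k, hk⟩ := exists_nat_ge (g y)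
      exact Set.mem_iUnion.2 ⟨k, hy, by simp only [Set.mem_ofPred_eq]; linarith⟩
    refine measure_mono_null e (measure_iUnion_null fun k => ?_)
    rw [h.volume_openCone_inter_le A (by positivity), h1, mul_zero]
  obtain ⟨C, hC⟩ := h.lip
  have h3 : ∀ᵐ y, fderiv ℝ g y v ≤ 0 := by
    have : Nontrivial (Vec n) := ⟨v, 0, hv⟩
    have hne : ∀ᵐ y : Vec n, y ≠ 0 := by simp [ae_iff]
    filter_upwards [measure_eq_zero_iff_ae_notMem.1 h2, hne] with y hy hy0
    rw [hcone y hy0, not_lt, gradient, InnerProductSpace.toDual_symm_apply] at hy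
    exact hy
  have h4 := le_of_ae_fderiv_nonpos hC h3 0
  rw [zero_add, h.map_zero] at h4
  exact absurd h4 (not_le.2 (h.pos v hv))

theorem projFn_pos (h : IsLipGauge K g) (hn : 1 ≤ n) {p : ℝ} (hp : 1 ≤ p) {Q : Set (Vec m)}
    (hQ : IsConvexBody Q) (hQ0 : (0 : Vec m) ∈ Q) {x : Mat n m} (hx : x ≠ 0) :
    0 < projFn p Q K x := by
  have hp0 : 0 < p := by linarith
  obtain ⟨-, hQc, hQi⟩ := hQ
  rw [pos_iff_ne_zero]
  intro h0
  rw [h.projFn_eq hn hp hQc hQ0, ENNReal.rpow_eq_zero_iff_of_pos (by positivity), mul_eq_zero,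
    or_iff_right (ENNReal.inv_ne_zero.2 (coneConst_ne_top n)), lintegral_eq_zero_iff] at h0
  swap
  · exact (((continuous_supportFn hQc ⟨0, hQ0⟩).measurable.comp
      ((rowMulCLM x).continuous.measurable.comp (measurable_gradient g))).ennreal_ofReal).pow_const p
  obtain ⟨q, hq, hqx⟩ := exists_mulVec_ne_zero hQi hx
  refine h.not_ae_inner_gradient_nonpos hqx ?_
  filter_upwards [h0] with y hy
  simp only [Pi.zero_apply, ENNReal.rpow_eq_zero_iff_of_pos hp0, ENNReal.ofReal_eq_zero] at hy
  rw [← inner_rowMul]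
  exact (inner_le_supportFn hQc _ hq).trans hy

theorem isSublinear_projFn (h : IsLipGauge K g) (hn : 1 ≤ n) {p : ℝ} (hp : 1 ≤ p)
    {Q : Set (Vec m)} (hQ : IsCompact Q) (hQ0 : (0 : Vec m) ∈ Q) :
    IsSublinear (projFn p Q K : Mat n m → ℝ≥0∞) := by
  have hp0 : 0 < p := by linarith
  have hmeas : ∀ x : Mat n m, Measurable fun y =>
      ENNReal.ofReal (supportFn Q (rowMul (gradient g y) x)) := fun x =>
    ((continuous_supportFn hQ ⟨0, hQ0⟩).measurable.comp
      ((rowMulCLM x).continuous.measurable.comp (measurable_gradient g))).ennreal_ofReal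
  constructor
  · intro x y
    rw [h.projFn_eq hn hp hQ hQ0, h.projFn_eq hn hp hQ hQ0, h.projFn_eq hn hp hQ hQ0,
      ENNReal.mul_rpow_of_nonneg _ _ (by positivity), ENNReal.mul_rpow_of_nonneg _ _ (by positivity),
      ENNReal.mul_rpow_of_nonneg _ _ (by positivity), ← mul_add]
    gcongr
    -- Minkowski's inequality in `L^p`, applied after subadditivity of `h_Q` inside the integral.
    refine le_trans ?_ (ENNReal.lintegral_Lp_add_le (hmeas x).aemeasurable (hmeas y).aemeasurable hp)
    gcongr with z
    rw [Pi.add_apply, ← ENNReal.ofReal_add (supportFn_nonneg hQ hQ0 _) (supportFn_nonneg hQ hQ0 _),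
      rowMul_add_right]
    exact ENNReal.ofReal_le_ofReal (supportFn_add_le hQ ⟨0, hQ0⟩ _ _)
  · intro c x hc
    rw [h.projFn_eq hn hp hQ hQ0, h.projFn_eq hn hp hQ hQ0]
    simp_rw [rowMul_smul_right, supportFn_smul hc, ENNReal.ofReal_mul hc,
      ENNReal.mul_rpow_of_nonneg _ _ hp0.le]
    rw [lintegral_const_mul _ ((hmeas x).pow_const p), mul_left_comm,
      ENNReal.mul_rpow_of_nonneg _ _ (by positivity), ← ENNReal.rpow_mul,
      mul_one_div_cancel hp0.ne', ENNReal.rpow_one]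

end IsLipGauge

/-! ### Behaviour under linear maps -/

section LinearImage

variable {n m : ℕ}

/-- The continuous linear map on `ℝⁿ` given by a matrix. -/
def matCLM (A : Mat n n) : Vec n →L[ℝ] Vec n :=
  LinearMap.toContinuousLinearMap (Matrix.toEuclideanLin A)

theorem matCLM_apply (A : Mat n n) (v : Vec n) :
    matCLM A v = WithLp.toLp 2 (A.mulVec v.ofLp) := by
  simp [matCLM, Matrix.toLpLin_apply]

theorem matCLM_matCLM (A B : Mat n n) (v : Vec n) : matCLM A (matCLM B v) = matCLM (A * B) v := by
  simp [matCLM_apply]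

theorem matCLM_one (v : Vec n) : matCLM (1 : Mat n n) v = v := by
  simp [matCLM_apply]

theorem det_matCLM (A : Mat n n) : LinearMap.det (matCLM A : Vec n →ₗ[ℝ] Vec n) = A.det := by
  simp [matCLM, Matrix.toEuclideanLin, Matrix.toLpLin_eq_toLin]

/-- The linear automorphism of `ℝⁿ` given by an element of `GL(n)`. -/
def matCLE (φ : Matrix.GeneralLinearGroup (Fin n) ℝ) : Vec n ≃L[ℝ] Vec n :=
  ContinuousLinearEquiv.equivOfInverse (matCLM (φ : Mat n n))
    (matCLM ((φ⁻¹ : Matrix.GeneralLinearGroup (Fin n) ℝ) : Mat n n))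
    (fun v => by rw [matCLM_matCLM, ← Units.val_mul, inv_mul_cancel, Units.val_one, matCLM_one])
    (fun v => by rw [matCLM_matCLM, ← Units.val_mul, mul_inv_cancel, Units.val_one, matCLM_one])

theorem matCLE_apply (φ : Matrix.GeneralLinearGroup (Fin n) ℝ) (v : Vec n) :
    matCLE φ v = WithLp.toLp 2 ((φ : Mat n n).mulVec v.ofLp) := matCLM_apply _ _

theorem matCLE_symm (φ : Matrix.GeneralLinearGroup (Fin n) ℝ) :
    (matCLE φ).symm = matCLE φ⁻¹ := by
  ext v
  rfl

/-- The chain rule `∇(g ∘ φ)(y) = φᵀ ∇g(φ y)`, valid without differentiability since `φ` is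
invertible. -/
theorem rowMul_gradient_comp_matCLE (g : Vec n → ℝ) (φ : Matrix.GeneralLinearGroup (Fin n) ℝ)
    (y : Vec n) (x : Mat n m) :
    rowMul (gradient (g ∘ matCLE φ) y) x = rowMul (gradient g (matCLE φ y)) ((φ : Mat n n) * x) := by
  refine ext_inner_right ℝ fun q => ?_
  have e : matCLE φ (WithLp.toLp 2 (x.mulVec q.ofLp)) =
      WithLp.toLp 2 (((φ : Mat n n) * x).mulVec q.ofLp) := by
    rw [matCLE_apply, ← Matrix.mulVec_mulVec]
  rw [inner_rowMul, inner_rowMul, gradient, gradient, InnerProductSpace.toDual_symm_apply,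
    InnerProductSpace.toDual_symm_apply, ContinuousLinearEquiv.comp_right_fderiv,
    ContinuousLinearMap.comp_apply, ContinuousLinearEquiv.coe_coe, e]

theorem linImage_eq_preimage (φ : Matrix.GeneralLinearGroup (Fin n) ℝ) (K : Set (Vec n)) :
    linImage (φ : Mat n n) K = matCLE φ⁻¹ ⁻¹' K := by
  rw [← matCLE_symm, ← (matCLE φ).image_eq_preimage_symm]
  exact Set.image_congr fun z _ => (matCLE_apply φ z).symm

theorem IsLipGauge.linImage {K : Set (Vec n)} {g : Vec n → ℝ} (h : IsLipGauge K g)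
    (φ : Matrix.GeneralLinearGroup (Fin n) ℝ) :
    IsLipGauge (linImage (φ : Mat n n) K) (g ∘ matCLE φ⁻¹) := by
  rw [linImage_eq_preimage]
  obtain ⟨C, hC⟩ := h.lip
  refine ⟨⟨_, hC.comp (matCLE φ⁻¹).lipschitz⟩, fun t x ht => ?_, fun x hx => h.pos _ ?_,
    fun x hx => h.mem_of_lt _ hx, fun x hx => h.le_of_mem _ hx⟩
  · simp only [Function.comp_apply, _root_.map_smul, h.map_smul _ _ ht]
  · simpa using hx

/-- The gauge of `φK` is `g ∘ φ⁻¹`; substituting `φ⁻¹ y` in the volume formula produces the Jacobian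
`|det φ|`. -/
theorem IsLipGauge.projFn_linImage {K : Set (Vec n)} {g : Vec n → ℝ} (h : IsLipGauge K g)
    (hn : 1 ≤ n) {p : ℝ} (hp : 1 ≤ p) {Q : Set (Vec m)} (hQ : IsCompact Q)
    (hQ0 : (0 : Vec m) ∈ Q) (φ : Matrix.GeneralLinearGroup (Fin n) ℝ) (x : Mat n m) :
    projFn p Q (StarProj.linImage (φ : Mat n n) K) x =
      ENNReal.ofReal (|(φ : Mat n n).det| ^ (1 / p)) *
        projFn p Q K (((φ⁻¹ : Matrix.GeneralLinearGroup (Fin n) ℝ) : Mat n n) * x) := by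
  have hp0 : 0 < p := by linarith
  set ψ := φ⁻¹ with hψ
  have hdet : (ψ : Mat n n).det * (φ : Mat n n).det = 1 := by
    rw [← Matrix.det_mul, ← Units.val_mul, hψ, inv_mul_cancel, Units.val_one, Matrix.det_one]
  rw [(h.linImage φ).projFn_eq hn hp hQ hQ0, h.projFn_eq hn hp hQ hQ0]
  set G : Vec n → ℝ≥0∞ := fun y =>
    ENNReal.ofReal (supportFn Q (rowMul (gradient g y) ((ψ : Mat n n) * x))) ^ p with hG
  have hGm : Measurable G :=
    (((continuous_supportFn hQ ⟨0, hQ0⟩).measurable.comp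
      ((rowMulCLM _).continuous.measurable.comp (measurable_gradient g))).ennreal_ofReal).pow_const p
  have hS : MeasurableSet {y : Vec n | g y ≤ 1} :=
    (isClosed_le h.continuous continuous_const).measurableSet
  have hmap : (volume : Measure (Vec n)).map (matCLE ψ) =
      ENNReal.ofReal |(φ : Mat n n).det| • volume := by
    have hd : LinearMap.det (matCLM (ψ : Mat n n) : Vec n →ₗ[ℝ] Vec n) ≠ 0 := by
      rw [det_matCLM]
      exact left_ne_zero_of_mul_eq_one hdet
    have := Measure.map_linearMap_addHaar_eq_smul_addHaar (volume : Measure (Vec n)) hd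
    rw [det_matCLM, inv_eq_of_mul_eq_one_right hdet] at this
    exact this
  have e : ∫⁻ y in {y | (g ∘ matCLE ψ) y ≤ 1},
      ENNReal.ofReal (supportFn Q (rowMul (gradient (g ∘ matCLE ψ) y) x)) ^ p =
      ENNReal.ofReal |(φ : Mat n n).det| * ∫⁻ y in {y | g y ≤ 1}, G y := by
    simp_rw [rowMul_gradient_comp_matCLE]
    change ∫⁻ y in matCLE ψ ⁻¹' {y | g y ≤ 1}, G (matCLE ψ y) = _
    rw [← setLIntegral_map hS hGm (matCLE ψ).continuous.measurable, hmap, Measure.restrict_smul,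
      lintegral_smul_measure, smul_eq_mul]
  rw [e, mul_left_comm, ENNReal.mul_rpow_of_nonneg _ _ (by positivity),
    ENNReal.ofReal_rpow_of_nonneg (abs_nonneg _) (by positivity)]

end LinearImage

/-! ### Wulff sets of sublinear functions on matrices -/

section MatInner

variable {n m : ℕ}

theorem matInner_eq_sum (x y : Mat n m) : matInner x y = ∑ i, ∑ j, x i j * y i j := by
  rw [matInner, Matrix.trace, Finset.sum_comm]
  simp [Matrix.mul_apply]

theorem matInner_add_right (x y z : Mat n m) :
    matInner x (y + z) = matInner x y + matInner x z := by
  simp [matInner, Matrix.mul_add]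

theorem matInner_smul_right (c : ℝ) (x y : Mat n m) :
    matInner x (c • y) = c * matInner x y := by
  simp [matInner]

theorem matInner_single (i : Fin n) (j : Fin m) (c : ℝ) (y : Mat n m) :
    matInner (Matrix.single i j c) y = c * y i j := by
  rw [matInner_eq_sum, Finset.sum_eq_single i, Finset.sum_eq_single j]
  · simp
  · intro b _ hb; simp [hb.symm]
  · simp
  · intro b _ hb; simp [hb.symm]
  · simp

theorem matInner_transpose_mul (A : Mat n n) (x y : Mat n m) :
    matInner x (A.transpose * y) = matInner (A * x) y := by
  simp [matInner, Matrix.transpose_mul, Matrix.mul_assoc]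

theorem continuous_matInner (x : Mat n m) : Continuous (matInner x) := by
  simp_rw [funext fun y => matInner_eq_sum x y]
  exact continuous_finsetSum _ fun i _ => continuous_finsetSum _ fun j _ =>
    continuous_const.mul (continuous_apply_apply i j)

end MatInner

section Wulff

variable {n m : ℕ}

/-- The set of all `y` with `x · y ≤ N x` for every `x`. -/
def wulffSet (N : Mat n m → ℝ) : Set (Mat n m) := {y | ∀ x, matInner x y ≤ N x}

/-- A real-valued sublinear function on `M_{n,m}(ℝ)` which is positive away from the origin. -/
structure IsPosSublinear (N : Mat n m → ℝ) : Prop where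
  add_le : ∀ x y, N (x + y) ≤ N x + N y
  map_smul : ∀ (c : ℝ) (x), 0 ≤ c → N (c • x) = c * N x
  pos : ∀ x, x ≠ 0 → 0 < N x

namespace IsPosSublinear

variable {N : Mat n m → ℝ}

theorem map_zero (h : IsPosSublinear N) : N 0 = 0 := by
  simpa using h.map_smul 0 0 le_rfl

theorem nonneg (h : IsPosSublinear N) (x : Mat n m) : 0 ≤ N x := by
  rcases eq_or_ne x 0 with rfl | hx
  · exact h.map_zero.ge
  · exact (h.pos x hx).le

theorem convex_wulffSet (N : Mat n m → ℝ) : Convex ℝ (wulffSet N) := by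
  intro y hy z hz a b ha hb hab x
  rw [matInner_add_right, matInner_smul_right, matInner_smul_right]
  have h1 := mul_le_mul_of_nonneg_left (hy x) ha
  have h2 := mul_le_mul_of_nonneg_left (hz x) hb
  have h3 : a * N x + b * N x = N x := by rw [← add_mul, hab, one_mul]
  linarith

/-- Testing against the matrix units and their negatives confines every entry to an interval. -/
theorem isCompact_wulffSet (N : Mat n m → ℝ) : IsCompact (wulffSet N) := by
  have hcl : IsClosed (wulffSet N) := by
    have : wulffSet N = ⋂ x, {y | matInner x y ≤ N x} := by
      ext y; simp [wulffSet]
    rw [this]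
    exact isClosed_iInter fun x => isClosed_le (continuous_matInner x) continuous_const
  have hc : IsCompact (Set.univ.pi fun i => Set.univ.pi fun j =>
      Set.Icc (-N (Matrix.single i j (-1))) (N (Matrix.single i j 1)) : Set (Mat n m)) :=
    isCompact_univ_pi fun i => isCompact_univ_pi fun j => isCompact_Icc
  refine hc.of_isClosed_subset hcl fun y hy i _ j _ => ?_
  have h1 := (matInner_single i j 1 y).ge.trans (hy _)
  have h2 := (matInner_single i j (-1) y).ge.trans (hy _)
  constructor <;> linarith

/-- A finite convex function in finite dimension is continuous, so `N` has a positive minimum on the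
sphere and dominates `μ ‖x‖`. For the entrywise sup norm `x · y ≤ nm ‖x‖ ‖y‖`, which fixes the
radius of the ball. -/
theorem zero_mem_interior_wulffSet (h : IsPosSublinear N) :
    (0 : Mat n m) ∈ interior (wulffSet N) := by
  let : NormedAddCommGroup (Mat n m) := Matrix.normedAddCommGroup
  let : NormedSpace ℝ (Mat n m) := Matrix.normedSpace
  have hconv : ConvexOn ℝ Set.univ N := by
    refine ⟨convex_univ, fun x _ y _ a b ha hb _ => ?_⟩
    rw [smul_eq_mul, smul_eq_mul, ← h.map_smul a x ha, ← h.map_smul b y hb]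
    exact h.add_le _ _
  have hcont : Continuous N := by
    rw [← continuousOn_univ]
    exact hconv.continuousOn isOpen_univ
  have hmin : ∃ μ : ℝ, 0 < μ ∧ ∀ u ∈ Metric.sphere (0 : Mat n m) 1, μ ≤ N u := by
    rcases (Metric.sphere (0 : Mat n m) 1).eq_empty_or_nonempty with he | hne
    · exact ⟨1, one_pos, by simp [he]⟩
    · have : ProperSpace (Mat n m) := FiniteDimensional.proper ℝ _
      obtain ⟨u₀, hu₀, hmin⟩ :=
        (isCompact_sphere (0 : Mat n m) 1).exists_isMinOn hne hcont.continuousOn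
      refine ⟨N u₀, h.pos u₀ ?_, fun u hu => hmin hu⟩
      rintro rfl
      simp at hu₀
  obtain ⟨μ, hμ, hmin⟩ := hmin
  have hlow : ∀ x : Mat n m, μ * ‖x‖ ≤ N x := by
    intro x
    rcases eq_or_ne x 0 with rfl | hx
    · simp [h.map_zero]
    have hx' : 0 < ‖x‖ := norm_pos_iff.2 hx
    have h1 := hmin (‖x‖⁻¹ • x) (by simp [norm_smul, inv_mul_cancel₀ hx'.ne'])
    rwa [h.map_smul _ _ (inv_nonneg.2 hx'.le), ← div_eq_inv_mul, le_div_iff₀ hx'] at h1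
  have hup : ∀ x y : Mat n m, matInner x y ≤ (n * m : ℝ) * (‖x‖ * ‖y‖) := by
    intro x y
    rw [matInner_eq_sum]
    calc ∑ i, ∑ j, x i j * y i j ≤ ∑ i : Fin n, ∑ j : Fin m, ‖x‖ * ‖y‖ := by
          refine Finset.sum_le_sum fun i _ => Finset.sum_le_sum fun j _ => ?_
          refine (le_abs_self _).trans ?_
          rw [abs_mul]
          exact mul_le_mul (Matrix.norm_entry_le_entrywise_sup_norm x)
            (Matrix.norm_entry_le_entrywise_sup_norm y) (abs_nonneg _) (norm_nonneg _)
      _ = _ := by simp [mul_assoc]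
  have hε : 0 < μ / (n * m + 1 : ℝ) := by positivity
  refine mem_interior.2 ⟨Metric.ball 0 (μ / (n * m + 1 : ℝ)), fun y hy x => ?_,
    Metric.isOpen_ball, Metric.mem_ball_self hε⟩
  rw [mem_ball_zero_iff, lt_div_iff₀ (by positivity)] at hy
  refine (hup x y).trans (le_trans ?_ (hlow x))
  have : (n * m : ℝ) * ‖y‖ ≤ μ := by nlinarith [norm_nonneg y]
  nlinarith [norm_nonneg x]

/-- Hahn–Banach: the functional `c x ↦ c N(x)` on the line through `x` extends to a linear
functional below `N`; the matrix representing it lies in the Wulff set and attains `N(x)`. -/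
theorem matSupportFn_wulffSet (h : IsPosSublinear N) (x : Mat n m) :
    matSupportFn (wulffSet N) x = N x := by
  refine IsGreatest.csSup_eq ⟨?_, by rintro _ ⟨y, hy, rfl⟩; exact hy x⟩
  have hex : ∃ f : Mat n m →ₗ[ℝ] ℝ, f x = N x ∧ ∀ z, f z ≤ N z := by
    rcases eq_or_ne x 0 with rfl | hx
    · exact ⟨0, by simp [h.map_zero], fun z => h.nonneg z⟩
    obtain ⟨f, hf, hfN⟩ := exists_extension_of_le_sublinear
      (LinearPMap.mkSpanSingleton x (N x) hx) N (fun c hc z => h.map_smul c z hc.le) h.add_le (by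
        rintro ⟨z, hz⟩
        obtain ⟨c, rfl⟩ := Submodule.mem_span_singleton.1 hz
        rw [show LinearPMap.mkSpanSingleton x (N x) hx ⟨c • x, hz⟩ = c * N x from
          LinearPMap.mkSpanSingleton'_apply _ _ _ _ _]
        -- For `c ≤ 0` the domination is a matter of sign: `c N(x) ≤ 0 ≤ N(c x)`.
        rcases le_total 0 c with hc | hc
        · rw [h.map_smul c x hc]
        · exact (mul_nonpos_of_nonpos_of_nonneg hc (h.nonneg x)).trans (h.nonneg _))
    refine ⟨f, ?_, hfN⟩
    exact (hf ⟨x, Submodule.mem_span_singleton_self x⟩).trans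
      (LinearPMap.mkSpanSingleton_apply ℝ ℝ hx (N x))
  obtain ⟨f, hfx, hfN⟩ := hex
  set y : Mat n m := Matrix.of fun i j => f (Matrix.single i j 1) with hy
  have hrep : ∀ z, matInner z y = f z := by
    intro z
    conv_rhs => rw [Matrix.matrix_eq_sum_single z]
    rw [matInner_eq_sum, map_sum]
    refine Finset.sum_congr rfl fun i _ => ?_
    rw [map_sum]
    refine Finset.sum_congr rfl fun j _ => ?_
    rw [hy, Matrix.of_apply, ← smul_eq_mul, ← _root_.map_smul, Matrix.smul_single, smul_eq_mul,
      mul_one]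
  exact ⟨y, fun z => (hrep z).trans_le (hfN z), (hrep x).trans hfx⟩

end IsPosSublinear

end Wulff

/-! ### Transformation rules for the projection body -/

section ProjBody

variable {n m : ℕ} {p : ℝ} {Q Q' : Set (Vec m)} {K K' : Set (Vec n)}

/-- Substitute `φ x` for `x` in the defining inequalities and move the matrix across the inner
product. Dilations and linear images both reduce to this. -/
theorem projBody_eq_of_projFn_eq {c : ℝ} (hc : 0 < c)
    (φ : Matrix.GeneralLinearGroup (Fin n) ℝ)
    (h : ∀ x : Mat n m, projFn p Q' K' x = ENNReal.ofReal c *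
      projFn p Q K (((φ⁻¹ : Matrix.GeneralLinearGroup (Fin n) ℝ) : Mat n n) * x)) :
    (projBody p Q' K' : Set (Mat n m)) =
      c • mulImage (((φ⁻¹ : Matrix.GeneralLinearGroup (Fin n) ℝ) : Mat n n).transpose)
        (projBody p Q K) := by
  have hφ : (φ : Mat n n) * ((φ⁻¹ : Matrix.GeneralLinearGroup (Fin n) ℝ) : Mat n n) = 1 := by
    rw [← Units.val_mul, mul_inv_cancel, Units.val_one]
  have hφ' : ((φ⁻¹ : Matrix.GeneralLinearGroup (Fin n) ℝ) : Mat n n) * (φ : Mat n n) = 1 := by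
    rw [← Units.val_mul, inv_mul_cancel, Units.val_one]
  have hscale : ∀ (t : ℝ) (b : ℝ≥0∞),
      ENNReal.ofReal (c * t) ≤ ENNReal.ofReal c * b ↔ ENNReal.ofReal t ≤ b := by
    intro t b
    rw [ENNReal.ofReal_mul hc.le]
    exact ENNReal.mul_le_mul_iff_right (by simpa using hc) ENNReal.ofReal_ne_top
  ext y
  rw [Set.mem_smul_set_iff_inv_smul_mem₀ hc.ne']
  constructor
  · intro hy
    refine ⟨(φ : Mat n n).transpose * (c⁻¹ • y), fun x => ?_, ?_⟩
    · rw [matInner_transpose_mul, matInner_smul_right, ← hscale, mul_inv_cancel_left₀ hc.ne']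
      have := hy ((φ : Mat n n) * x)
      rwa [h, ← Matrix.mul_assoc, hφ', Matrix.one_mul] at this
    · change _ * (_ * _) = _
      rw [← Matrix.mul_assoc, ← Matrix.transpose_mul, hφ, Matrix.transpose_one, Matrix.one_mul]
  · rintro ⟨z, hz, hzy⟩ x
    have hzy : _ * z = c⁻¹ • y := hzy
    have e : y = c • (((φ⁻¹ : Matrix.GeneralLinearGroup (Fin n) ℝ) : Mat n n).transpose * z) :=
      ((eq_inv_smul_iff₀ hc.ne').1 hzy).symm
    rw [e, h, matInner_smul_right, matInner_transpose_mul, hscale]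
    exact hz _

theorem IsLipGauge.projFn_smul_set {g : Vec n → ℝ} (h : IsLipGauge K g)
    (hn : 1 ≤ n) (hp : 1 ≤ p) (hQ : IsCompact Q) (hQ0 : (0 : Vec m) ∈ Q) {b : ℝ} (hb : 0 < b)
    (x : Mat n m) : projFn p (b • Q) K x = ENNReal.ofReal b * projFn p Q K x := by
  have hbQ0 : (0 : Vec m) ∈ b • Q := ⟨0, hQ0, smul_zero b⟩
  rw [← (h.isSublinear_projFn hn hp hQ hQ0).2 b x hb.le, h.projFn_eq hn hp (hQ.smul b) hbQ0,
    h.projFn_eq hn hp hQ hQ0]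
  simp_rw [supportFn_smul_set hb.le, rowMul_smul_right, supportFn_smul hb.le]

end ProjBody

/-- Where `x · y` is negative, both the extended and the real inequality hold trivially. -/
theorem projBody_eq_wulffSet {n m : ℕ} {p : ℝ} {Q : Set (Vec m)} {K : Set (Vec n)}
    (hfin : ∀ x : Mat n m, projFn p Q K x < ⊤) :
    (projBody p Q K : Set (Mat n m)) = wulffSet fun x => (projFn p Q K x).toReal := by
  ext y
  exact forall_congr' fun x => ENNReal.ofReal_le_iff_le_toReal (hfin x).ne

theorem IsSublinear.isPosSublinear_toReal {n m : ℕ} {f : Mat n m → ℝ≥0∞} (h : IsSublinear f)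
    (hfin : ∀ x, f x < ⊤) (hpos : ∀ x, x ≠ 0 → 0 < f x) :
    IsPosSublinear fun x => (f x).toReal where
  add_le x y := by
    rw [← ENNReal.toReal_add (hfin x).ne (hfin y).ne]
    exact ENNReal.toReal_mono (ENNReal.add_ne_top.2 ⟨(hfin x).ne, (hfin y).ne⟩) (h.1 x y)
  map_smul c x hc := by rw [h.2 c x hc, ENNReal.toReal_mul, ENNReal.toReal_ofReal hc]
  pos x hx := ENNReal.toReal_pos (hpos x hx).ne' (hfin x).ne

theorem smul_set_eq_linImage {n : ℕ} {a : ℝ} (ha : a ≠ 0) (K : Set (Vec n)) :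
    a • K = linImage ((Units.map (algebraMap ℝ (Mat n n)).toMonoidHom (Units.mk0 a ha) :
      Matrix.GeneralLinearGroup (Fin n) ℝ) : Mat n n) K := by
  rw [← Set.image_smul]
  refine Set.image_congr fun z _ => ?_
  ext i
  simp [Matrix.algebraMap_eq_diagonal, Matrix.mulVec_diagonal]

end StarProj

end

theorem proposition5p2 (n m : ℕ) (hn : 1 ≤ n) (hm : 1 ≤ m) (p : ℝ) (hp : 1 ≤ p)
    (Q : Set (StarProj.Vec m)) (hQ : StarProj.IsConvexBody Q) (hQ0 : (0 : StarProj.Vec m) ∈ Q)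
    (K : Set (StarProj.Vec n)) (hK : StarProj.IsLipschitzStarBody K) :
    -- finiteness and positivity on the unit sphere
    (∀ u : StarProj.Mat n m, StarProj.matNorm u = 1 →
      0 < StarProj.projFn p Q K u ∧ StarProj.projFn p Q K u < ⊤) ∧
    -- sublinearity, and the convex body with this support function
    StarProj.IsSublinear (StarProj.projFn p Q K : StarProj.Mat n m → ℝ≥0∞) ∧
    (StarProj.IsConvexBody (StarProj.projBody p Q K : Set (StarProj.Mat n m)) ∧
      (0 : StarProj.Mat n m) ∈ interior (StarProj.projBody p Q K) ∧
      ∀ x : StarProj.Mat n m,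
        StarProj.projFn p Q K x =
          ENNReal.ofReal (StarProj.matSupportFn (StarProj.projBody p Q K) x)) ∧
    -- homogeneity
    (∀ a b : ℝ, 0 < a → 0 < b →
      (StarProj.projBody p (b • Q) (a • K) : Set (StarProj.Mat n m)) =
        (b * a ^ (((n : ℝ) - p) / p)) • StarProj.projBody p Q K) ∧
    -- affine invariance
    (∀ φ : Matrix.GeneralLinearGroup (Fin n) ℝ,
      (StarProj.projBody p Q (StarProj.linImage (φ : StarProj.Mat n n) K) :
          Set (StarProj.Mat n m)) =
        (|(φ : StarProj.Mat n n).det| ^ (1 / p)) •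
          StarProj.mulImage
            (((φ⁻¹ : Matrix.GeneralLinearGroup (Fin n) ℝ) : StarProj.Mat n n).transpose)
            (StarProj.projBody p Q K)) := by
  have hp0 : 0 < p := by linarith
  obtain ⟨g, hg⟩ := hK.exists_lipGauge hn
  have hQc : IsCompact Q := hQ.2.1
  have hfin : ∀ x : StarProj.Mat n m, StarProj.projFn p Q K x < ⊤ :=
    hg.projFn_lt_top hn hp hQc hQ0
  have hpos : ∀ x : StarProj.Mat n m, x ≠ 0 → 0 < StarProj.projFn p Q K x := fun x hx =>
    hg.projFn_pos hn hp hQ hQ0 hx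
  have hsub : StarProj.IsSublinear (StarProj.projFn p Q K : StarProj.Mat n m → ℝ≥0∞) :=
    hg.isSublinear_projFn hn hp hQc hQ0
  have hN := hsub.isPosSublinear_toReal hfin hpos
  refine ⟨fun u hu => ⟨hpos u ?_, hfin u⟩, hsub, ⟨⟨?_, ?_, ?_⟩, ?_, fun x => ?_⟩,
    fun a b ha hb => ?_, fun φ => ?_⟩
  · rintro rfl
    simp [StarProj.matNorm, StarProj.matInner] at hu
  · rw [StarProj.projBody_eq_wulffSet hfin]
    exact StarProj.IsPosSublinear.convex_wulffSet _
  · rw [StarProj.projBody_eq_wulffSet hfin]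
    exact StarProj.IsPosSublinear.isCompact_wulffSet _
  · rw [StarProj.projBody_eq_wulffSet hfin]
    exact ⟨0, hN.zero_mem_interior_wulffSet⟩
  · rw [StarProj.projBody_eq_wulffSet hfin]
    exact hN.zero_mem_interior_wulffSet
  · rw [StarProj.projBody_eq_wulffSet hfin, hN.matSupportFn_wulffSet,
      ENNReal.ofReal_toReal (hfin x).ne]
  · have hc : 0 < b * a ^ (((n : ℝ) - p) / p) := by positivity
    -- View `a • K` as the image of `K` under `a` times the identity. The determinant contributes `a
    -- ^ (n/p)` and the inverse matrix contributes `a⁻¹`, for a total of `a ^ ((n - p)/p)`; the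
    -- factor `b` comes from `Q`.
    have key := StarProj.projBody_eq_of_projFn_eq (p := p) (Q := Q) (Q' := b • Q) (K := K)
      (K' := a • K) (m := m) hc 1 fun x => by
        rw [StarProj.smul_set_eq_linImage ha.ne',
          (hg.linImage _).projFn_smul_set hn hp hQc hQ0 hb, hg.projFn_linImage hn hp hQc hQ0]
        have e : ((((Units.map (algebraMap ℝ (StarProj.Mat n n)).toMonoidHom
            (Units.mk0 a ha.ne'))⁻¹ : Matrix.GeneralLinearGroup (Fin n) ℝ) : StarProj.Mat n n) * x)
            = a⁻¹ • x := by
          rw [← map_inv]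
          ext i j
          simp [Matrix.algebraMap_eq_diagonal]
        have hd : ((Units.map (algebraMap ℝ (StarProj.Mat n n)).toMonoidHom
            (Units.mk0 a ha.ne') : Matrix.GeneralLinearGroup (Fin n) ℝ) : StarProj.Mat n n).det
            = a ^ n := by
          simp [Matrix.algebraMap_eq_diagonal]
        rw [e, hd, hsub.2 _ _ (inv_pos.2 ha).le, ← mul_assoc, ← mul_assoc,
          ← ENNReal.ofReal_mul hb.le, ← ENNReal.ofReal_mul (by positivity), inv_one, Units.val_one,
          Matrix.one_mul, abs_of_pos (by positivity), mul_assoc, ← Real.rpow_neg_one a,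
          ← Real.rpow_natCast a n, ← Real.rpow_mul ha.le, ← Real.rpow_add ha]
        congr 5
        field_simp
        ring
    rw [key]
    congr 1
    rw [inv_one, Units.val_one, Matrix.transpose_one, StarProj.mulImage]
    simp
  · refine StarProj.projBody_eq_of_projFn_eq ?_ φ (hg.projFn_linImage hn hp hQc hQ0 φ)
    have : (φ : StarProj.Mat n n).det ≠ 0 := (Matrix.isUnits_det_units φ).ne_zero
    positivity
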